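/- **Setting.** Let $n\ge 1$, $L>0$, and let $f_1,\dots,f_n:\mathbb R^d\to\mathbb R$ be differentiable, convex and $L$-smooth, i.e. $f_i(x)+\langle\nabla f_i(x),y-x\rangle\le f_i(y)\le f_i(x)+\langle\nabla f_i(x),y-x\rangle+\frac L2\|x-y\|^2$ for all $x,y$. Put $f=\frac1n\sum_i f_i$ and let $x^*$ be a minimizer of $f$. Let $C\in\mathbb R^{n\times n}$ be column stochastic (nonnegative entries, $\mathbf 1^\top C=\mathbf 1^\top$) and regular (some power $C^\ell$ has only positive entries). For $X\in\mathbb R^{n\times d}$ with rows $x_1,\dots,x_n$ let $\nabla F(X)$ be the matrix with rows $\nabla f_i(x_i)$. **Algorithm (accelerated Push-DIGing).** Given $X_0\in\mathbb R^{n\times d}$, $v_0\in\mathbb R^n$ with $v_0>0$ and $\mathbf 1^\top v_0=n$, and a step size $\eta$, put $V_k=\mathrm{Diag}(v_k)$, $\tau_k=\frac{\gamma}{1+\beta k}$, $\alpha_k=\frac{\theta}{\tau_k}$, $Y_0=Z_0=X_0$, $G_0=\nabla F(V_0^{-1}X_0)$, and for $k\ge 0$ $$v_{k+1}=Cv_k,\quad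 Y_{k+1}=C(X_k-\eta G_k),\quad Z_{k+1}=C(Z_k-\alpha_k\eta G_k),$$ $$X_{k+1}=(1-\tau_{k+1})Y_{k+1}+\tau_{k+1}Z_{k+1},\quad G_{k+1}=CG_k+\nabla F(V_{k+1}^{-1}X_{k+1})-\nabla F(V_k^{-1}X_k).$$ The output after $K$ iterations is $V_K^{-1}Y_K$, with rows $v_{K,i}^{-1}y_{K,i}$. Let $\bar x_0=\frac1n\mathbf 1^\top X_0$ (so $\bar y_0=\bar z_0=\bar x_0$). Let $\theta=\frac14$, $\gamma\in(0,1]$, $0<\beta\le\frac\gamma4$. **Norms and constants.** There is a unique positive vector $p$ with $Cp=p$, $\mathbf 1^\top p=n$, and $\rho\big(C-\frac{p\mathbf 1^\top}n\big)<1$. Put $\Pi=I-\frac{p\mathbf 1^\top}n$. For every $0<\delta<1-\rho\big(C-\frac{p\mathbf 1^\top}n\big)$ there are an invertible matrix $\widetilde C\in\mathbb R^{n\times n}$ and a constant $\kappa\ge1$ such that the vector norm $\|x\|_C=\|\widetilde Cx\|$ and its induced matrix norm satisfy $$\|x\|_C\le\|x\|\le\kappa\|x\|_C\ \ (x\in\mathbb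 R^n),\qquad \Big\|C-\tfrac{p\mathbf 1^\top}n\Big\|_C\le1-\delta,\qquad \|\Pi\|_C\le1.\tag{N}$$ For $A\in\mathbb R^{n\times d}$ let $\|A\|_C$ be the Euclidean norm of the vector of the norms $\|A_{:,l}\|_C$ of the columns, and $\|A\|$ the Frobenius norm. Let $$\nu=\Big(\inf_{k\ge0,\,i}v_{k,i}\Big)^{-1},\quad c_1=3(\delta^2+2\theta^2\delta+4\theta^2),\quad c_2=26\sqrt e,$$ $$\Phi^{(1)}_0=\|\bar x_0\|^2+\tfrac8{\delta^2}\tau_0^2\|\bar x_0\|^2,\qquad \Phi^{(2)}_0=\big(1+\tfrac6{\delta^2}\big)\|\Pi X_0\|_C^2+\tfrac{c_1\eta^2}{\delta^4}\|\Pi G_0\|_C^2 .$$ **Theorem.** The objects $p$, $\widetilde C$, $\kappa$ exist as just described. For every such $\delta$, every $\widetilde C,\kappa$ with (N), and every $\eta$ with $$0<\eta\le\min\Big\{\tfrac{\sqrt\theta\,\delta^4}{\sqrt{96(15+9\theta)c_1c_2}\,\kappa\nu L},\ \tfrac{n\theta\delta^6}{1920\|v_0-p\|_C^2\kappa^2\nu^2(1+\theta)^2c_2L},\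 \tfrac1{8\theta L},\ \tfrac{\delta^4}{12\kappa\nu\sqrt{c_1c_2(6+\theta)}\,L}\Big\}$$ (the second bound being $+\infty$ if $v_0=p$) and $$\eta\le\min\Big\{\tfrac{\sqrt\gamma\,\delta^4}{12\sqrt{3\beta c_1c_2}\,\kappa\nu L},\ \tfrac{\delta^4}{12\kappa\nu\sqrt{c_1c_2}\,L}\Big\},$$ one has, for all $K\ge1$, $$\frac1n\sum_{i=1}^n f\big(v_{K,i}^{-1}y_{K,i}\big)-f(x^*)\le\frac1{\alpha_{K-1}^2}\Big(1+3\theta+\tfrac{12\nu^2\kappa^2(1-\delta)^{2K}\|v_0-p\|_C^2\,\eta L}n\Big)$$ $$\cdot\Big(\tfrac{2(1-\tau_0)\alpha_0}{\tau_0}\big(f(\bar x_0)-f(x^*)\big)+\tfrac{3\kappa^2\nu^2L}n\tfrac{c_2\alpha_0}{\delta^3\tau_0}\Phi^{(2)}_0+\tfrac{3\kappa^2\nu^2L\|v_0-p\|_C^2}n\tfrac{c_2\alpha_0}{\delta^3\tau_0}\Phi^{(1)}_0+\tfrac{\|\bar x_0-x^*\|^2}{2\eta}\Big).$$ Moreover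 $\Phi^{(1)}_0\le\big(1+\frac8{\delta^2}\big)\|X_0\|^2$ and $\Phi^{(2)}_0\le\big(1+\frac6{\delta^2}\big)\|\Pi X_0\|^2+\frac{c_1\eta^2}{\delta^4}\|\Pi G_0\|^2$. In particular, since $\alpha_k$ grows linearly in $k$, the left-hand side of the bound is $O(1/K^2)$ as $K\to\infty$. -/

import Mathlib

open scoped Gradient RealInnerProductSpace

namespace PushDIGing

noncomputable section

/-- An `n`-by-`d` real matrix, stored through its rows: row `i` is the local variable in `ℝ^d`
of agent `i`. -/
abbrev RowMat (n d : ℕ) : Type := Fin n → EuclideanSpace ℝ (Fin d)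

/-! ### Objective functions -/

/-- `f` is convex and `L`-smooth:
`f x + ⟪∇f x, y - x⟫ ≤ f y ≤ f x + ⟪∇f x, y - x⟫ + (L / 2) ‖x - y‖²` for all `x`, `y`. -/
structure IsConvexSmooth {d : ℕ} (L : ℝ) (f : EuclideanSpace ℝ (Fin d) → ℝ) : Prop where
  differentiable : Differentiable ℝ f
  lower : ∀ x y, f x + ⟪∇ f x, y - x⟫ ≤ f y
  upper : ∀ x y, f y ≤ f x + ⟪∇ f x, y - x⟫ + L / 2 * ‖x - y‖ ^ 2

/-- The global objective `f = (1/n) ∑ i, f i`. -/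
def avgObj {n d : ℕ} (f : Fin n → EuclideanSpace ℝ (Fin d) → ℝ)
    (x : EuclideanSpace ℝ (Fin d)) : ℝ :=
  (1 / (n : ℝ)) * ∑ i, f i x

/-- `∇F(X)`: the matrix whose `i`-th row is the gradient of `f i` at the `i`-th row of `X`. -/
def gradF {n d : ℕ} (f : Fin n → EuclideanSpace ℝ (Fin d) → ℝ) (X : RowMat n d) : RowMat n d :=
  fun i => ∇ (f i) (X i)

/-! ### Matrix operations -/

/-- The matrix product `W X` of an `n`-by-`n` matrix and an `n`-by-`d` matrix. -/
def mix {n d : ℕ} (W : Matrix (Fin n) (Fin n) ℝ) (X : RowMat n d) : RowMat n d :=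
  fun i => ∑ j, W i j • X j

/-- `V⁻¹ X` with `V = Diag v`. -/
def invScale {n d : ℕ} (v : Fin n → ℝ) (X : RowMat n d) : RowMat n d :=
  fun i => (v i)⁻¹ • X i

/-- The average row `(1/n) 1ᵀ X`. -/
def rowMean {n d : ℕ} (X : RowMat n d) : EuclideanSpace ℝ (Fin d) :=
  (1 / (n : ℝ)) • ∑ i, X i

/-! ### The mixing matrix -/

/-- A column stochastic matrix that is regular: some power has only positive entries. -/
structure IsRegularColStochastic {n : ℕ} (C : Matrix (Fin n) (Fin n) ℝ) : Prop where
  colStochastic : C ∈ Matrix.colStochastic ℝ (Fin n)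
  regular : ∃ l : ℕ, ∀ i j, 0 < (C ^ l) i j

/-- `p` is a positive right eigenvector of `C` for the eigenvalue `1` with `1ᵀ p = n`. -/
structure IsPerronVector {n : ℕ} (C : Matrix (Fin n) (Fin n) ℝ) (p : Fin n → ℝ) : Prop where
  pos : ∀ i, 0 < p i
  eigen : C.mulVec p = p
  sum_eq : ∑ i, p i = n

/-- The rank-one matrix `p 1ᵀ / n`. -/
def perronProj {n : ℕ} (p : Fin n → ℝ) : Matrix (Fin n) (Fin n) ℝ :=
  (1 / (n : ℝ)) • Matrix.vecMulVec p 1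

/-- The consensus-error matrix `Π = I - p 1ᵀ / n`. -/
def conMat {n : ℕ} (p : Fin n → ℝ) : Matrix (Fin n) (Fin n) ℝ :=
  1 - perronProj p

/-- The spectral radius of `C - p 1ᵀ / n` (over the complex numbers). -/
def mixRadius {n : ℕ} (C : Matrix (Fin n) (Fin n) ℝ) (p : Fin n → ℝ) : ENNReal :=
  spectralRadius ℂ ((C - perronProj p).map (algebraMap ℝ ℂ))

/-! ### Norms -/

/-- The Euclidean norm on `ℝ^n`. -/
def euclNorm {n : ℕ} (x : Fin n → ℝ) : ℝ := ‖(WithLp.toLp 2 x : EuclideanSpace ℝ (Fin n))‖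

/-- The vector norm `‖x‖_C = ‖Ct x‖` induced by an invertible matrix `Ct`. -/
def vecNorm {n : ℕ} (Ct : Matrix (Fin n) (Fin n) ℝ) (x : Fin n → ℝ) : ℝ :=
  euclNorm (Ct.mulVec x)

/-- The norm of an `n`-by-`n` matrix induced by the vector norm `vecNorm Ct`. -/
def inducedNorm {n : ℕ} (Ct A : Matrix (Fin n) (Fin n) ℝ) : ℝ :=
  ⨆ x : {x : Fin n → ℝ // x ≠ 0}, vecNorm Ct (A.mulVec x) / vecNorm Ct x

/-- The norm of an `n`-by-`d` matrix that belongs to a vector norm `N` on `ℝ^n`: the Euclidean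
norm of the vector of the `N`-norms of the columns. -/
def colNorm {n d : ℕ} (N : (Fin n → ℝ) → ℝ) (A : RowMat n d) : ℝ :=
  euclNorm (fun l : Fin d => N (fun i => A i l))

/-- `‖·‖_C = ‖Ct ·‖` is a norm adapted to `C` with gap `δ` and equivalence constant `κ`.
(For `n ≥ 2` the matrix `Π` is a nonzero projection, so that `‖Π‖_C ≤ 1` means `‖Π‖_C = 1`;
for `n = 1` it is zero.) -/
structure IsAdaptedNorm {n : ℕ} (C : Matrix (Fin n) (Fin n) ℝ) (p : Fin n → ℝ) (δ : ℝ)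
    (Ct : Matrix (Fin n) (Fin n) ℝ) (κ : ℝ) : Prop where
  invertible : IsUnit Ct
  one_le : 1 ≤ κ
  le_eucl : ∀ x, vecNorm Ct x ≤ euclNorm x
  eucl_le : ∀ x, euclNorm x ≤ κ * vecNorm Ct x
  contract : inducedNorm Ct (C - perronProj p) ≤ 1 - δ
  proj : inducedNorm Ct (conMat p) ≤ 1

/-! ### The algorithm -/

/-- `τ_k = γ / (1 + β k)`. -/
def tau (β γ : ℝ) (k : ℕ) : ℝ := γ / (1 + β * k)

/-- `α_k = θ / τ_k`. -/
def alpha (θ β γ : ℝ) (k : ℕ) : ℝ := θ / tau β γ k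

/-- The variables of all agents at one iteration. -/
structure AlgState (n d : ℕ) where
  v : Fin n → ℝ
  X : RowMat n d
  Y : RowMat n d
  Z : RowMat n d
  G : RowMat n d

/-- Initialization `Y₀ = Z₀ = X₀`, `G₀ = ∇F(V₀⁻¹ X₀)`. -/
def initState {n d : ℕ} (f : Fin n → EuclideanSpace ℝ (Fin d) → ℝ)
    (X₀ : RowMat n d) (v₀ : Fin n → ℝ) : AlgState n d where
  v := v₀
  X := X₀
  Y := X₀
  Z := X₀
  G := gradF f (invScale v₀ X₀)

/-- The update from iteration `k` to iteration `k + 1` of accelerated Push-DIGing. -/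
def step {n d : ℕ} (f : Fin n → EuclideanSpace ℝ (Fin d) → ℝ) (C : Matrix (Fin n) (Fin n) ℝ)
    (θ β γ η : ℝ) (k : ℕ) (s : AlgState n d) : AlgState n d :=
  let v' : Fin n → ℝ := C.mulVec s.v
  let Y' : RowMat n d := mix C (s.X - η • s.G)
  let Z' : RowMat n d := mix C (s.Z - (alpha θ β γ k * η) • s.G)
  let X' : RowMat n d := (1 - tau β γ (k + 1)) • Y' + tau β γ (k + 1) • Z'
  { v := v'
    X := X'
    Y := Y'
    Z := Z'
    G := mix C s.G + gradF f (invScale v' X') - gradF f (invScale s.v s.X) }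

/-- The iterates of accelerated Push-DIGing. -/
def iter {n d : ℕ} (f : Fin n → EuclideanSpace ℝ (Fin d) → ℝ) (C : Matrix (Fin n) (Fin n) ℝ)
    (θ β γ η : ℝ) (X₀ : RowMat n d) (v₀ : Fin n → ℝ) : ℕ → AlgState n d
  | 0 => initState f X₀ v₀
  | k + 1 => step f C θ β γ η k (iter f C θ β γ η X₀ v₀ k)

/-- The output `V_K⁻¹ Y_K` after `K` iterations; row `i` is the estimate of agent `i`. -/
def output {n d : ℕ} (f : Fin n → EuclideanSpace ℝ (Fin d) → ℝ) (C : Matrix (Fin n) (Fin n) ℝ)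
    (θ β γ η : ℝ) (X₀ : RowMat n d) (v₀ : Fin n → ℝ) (K : ℕ) : RowMat n d :=
  invScale (iter f C θ β γ η X₀ v₀ K).v (iter f C θ β γ η X₀ v₀ K).Y

/-- The average optimality gap `(1/n) ∑ i, f (v_{K,i}⁻¹ y_{K,i}) - f x⋆` of the outputs. -/
def outputGap {n d : ℕ} (f : Fin n → EuclideanSpace ℝ (Fin d) → ℝ)
    (C : Matrix (Fin n) (Fin n) ℝ) (θ β γ η : ℝ) (X₀ : RowMat n d) (v₀ : Fin n → ℝ)
    (xstar : EuclideanSpace ℝ (Fin d)) (K : ℕ) : ℝ :=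
  (1 / (n : ℝ)) * ∑ i, avgObj f (output f C θ β γ η X₀ v₀ K i) - avgObj f xstar

/-! ### Constants and step-size conditions -/

/-- `1 / inf_{k, i} v_{k,i}`, where `v_k = C^k v₀`; it bounds all `‖V_k⁻¹‖`. -/
def vInvBound {n : ℕ} (C : Matrix (Fin n) (Fin n) ℝ) (v₀ : Fin n → ℝ) : ℝ :=
  (⨅ ki : ℕ × Fin n, ((C ^ ki.1).mulVec v₀) ki.2)⁻¹

/-- `c₁ = 3 (δ² + 2 θ² δ + 4 θ²)`. -/
def cOne (θ δ : ℝ) : ℝ := 3 * (δ ^ 2 + 2 * θ ^ 2 * δ + 4 * θ ^ 2)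

/-- `c₂ = 26 √e`. -/
def cTwo : ℝ := 26 * √(Real.exp 1)

/-- The first step-size condition; `a` stands for `‖v₀ - p‖_C` and `ν` for the bound on
`‖V_k⁻¹‖`. The second upper bound has `a²` in its denominator and is void for `a = 0`; it is
therefore written without division. -/
structure StepCond₁ (n : ℕ) (L θ δ κ ν a η : ℝ) : Prop where
  pos : 0 < η
  le₁ : η ≤ √θ * δ ^ 4 / (√(96 * (15 + 9 * θ) * cOne θ δ * cTwo) * κ * ν * L)
  le₂ : η * (1920 * a ^ 2 * κ ^ 2 * ν ^ 2 * (1 + θ) ^ 2 * cTwo * L) ≤ n * θ * δ ^ 6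
  le₃ : η ≤ 1 / (8 * θ * L)
  le₄ : η ≤ δ ^ 4 / (12 * κ * ν * √(cOne θ δ * cTwo * (6 + θ)) * L)

/-- The second step-size condition. -/
structure StepCond₂ (L θ β γ δ κ ν η : ℝ) : Prop where
  le₁ : η ≤ √γ * δ ^ 4 / (12 * √(3 * β * cOne θ δ * cTwo) * κ * ν * L)
  le₂ : η ≤ δ ^ 4 / (12 * κ * ν * √(cOne θ δ * cTwo) * L)

/-- `Φ¹₀ = ‖x̄₀‖² + (8 / δ²) τ₀² ‖z̄₀‖²`, where `z̄₀ = x̄₀`. -/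
def lyapOne {n d : ℕ} (β γ δ : ℝ) (X₀ : RowMat n d) : ℝ :=
  ‖rowMean X₀‖ ^ 2 + 8 / δ ^ 2 * tau β γ 0 ^ 2 * ‖rowMean X₀‖ ^ 2

/-- `Φ²₀ = (1 + 6 / δ²) ‖Π X₀‖_C² + (c₁ η² / δ⁴) ‖Π G₀‖_C²`, where `G₀ = ∇F(V₀⁻¹ X₀)`. -/
def lyapTwo {n d : ℕ} (f : Fin n → EuclideanSpace ℝ (Fin d) → ℝ) (p : Fin n → ℝ)
    (Ct : Matrix (Fin n) (Fin n) ℝ) (θ δ η : ℝ) (X₀ : RowMat n d) (v₀ : Fin n → ℝ) : ℝ :=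
  (1 + 6 / δ ^ 2) * colNorm (vecNorm Ct) (mix (conMat p) X₀) ^ 2
    + cOne θ δ * η ^ 2 / δ ^ 4
      * colNorm (vecNorm Ct) (mix (conMat p) (gradF f (invScale v₀ X₀))) ^ 2

end

end PushDIGing

namespace PushDIGing

/-! ### Scalar recursions -/

/-! Mixing preserves column sums and gradient tracking keeps the average of `G` equal to the average
of the local gradients at the rows w_i of V⁻¹X (`rowMean_iter_G`). Hence the averages x̄, ȳ, z̄ run
an accelerated gradient method with gradients evaluated at perturbed points. `accelerated_step` is
the usual potential inequality for such a step. Inexactness costs (L/n) ∑‖w_i - x̄‖², but since the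
lower bounds come from `IsConvexSmooth.lower_bregman`, two kinds of negative terms survive: a
multiple of ‖ḡ‖², and squared gradient differences against ȳ (weight 1 - τ) and against the
minimizer (weight τ). As (1 - τ_{k+1}) α_{k+1}² ≤ α_k², the step inequalities telescope.

What remains is to absorb the sum of α_k² ∑‖w_i - x̄‖². The distance of V⁻¹X from x̄ splits into the
consensus error ΠX and the imbalance (v_k - p) x̄, where v_k - p decays like (1 - δ)^k
(`IsAdaptedNorm.sum_invScale_sub_le`). The consensus errors of X, τZ and G combine into one scalar
that contracts by 1 - δ/2 with the change of the gradients as input (`sum_consensus_le`); the damped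
norms of the averages behave in the same way with input ‖ḡ‖ (`sum_average_le`). By
`weighted_gradient_change_le` the change of the gradients is controlled by the very gradient
differences that the descent inequality subtracts, plus ‖ḡ‖² and the error itself. For small η the
loop closes (`absorb_errors`), with no a priori bound on the iterates, and only initial errors are
left. Going from ȳ_K to the individual outputs costs a factor 2 and one more consensus error
(`avgObj_gap_le`).

The adapted norm is a Gelfand sum cut off at a power N with ‖M^N‖ ≤ ρ^N, where M = C - p1ᵀ/n and ρ =
1 - δ. It is a finite sum of quadratic forms, hence of the form ‖Ct x‖ (`exists_isAdaptedNorm`). -/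

/-- Square-summability of a sequence contracted by `1 - δ` up to an input `b`. -/
lemma sum_sq_le_of_contract {δ : ℝ} (hδ : 0 < δ) (hδ1 : δ ≤ 1) {a b : ℕ → ℝ}
    (ha : ∀ k, 0 ≤ a k) (h : ∀ k, a (k + 1) ≤ (1 - δ) * a k + b k) (m : ℕ) :
    ∑ k ∈ Finset.range (m + 1), a k ^ 2
      ≤ a 0 ^ 2 / δ + (∑ k ∈ Finset.range m, b k ^ 2) / δ ^ 2 := by
  -- The extra term `(1 - δ) * a m ^ 2` makes the induction close: together with the new summand `δ
  -- * a (m + 1) ^ 2` it forms a full square, to which one contraction step applies.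
  have key : δ * ∑ k ∈ Finset.range (m + 1), a k ^ 2 + (1 - δ) * a m ^ 2
      ≤ a 0 ^ 2 + (∑ k ∈ Finset.range m, b k ^ 2) / δ := by
    induction m with
    | zero => simp; linarith
    | succ m ih =>
      rw [Finset.sum_range_succ, Finset.sum_range_succ (fun k => b k ^ 2), add_div]
      have h1 : a (m + 1) ^ 2 ≤ ((1 - δ) * a m + b m) ^ 2 :=
        pow_le_pow_left₀ (ha _) (h m) 2
      -- Convexity of the square, for `a m` and `b m / δ` with weights `1 - δ` and `δ`.
      have h2 : ((1 - δ) * a m + b m) ^ 2 ≤ (1 - δ) * a m ^ 2 + b m ^ 2 / δ := by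
        have : (1 - δ) * a m ^ 2 + b m ^ 2 / δ - ((1 - δ) * a m + b m) ^ 2
            = (1 - δ) / δ * (δ * a m - b m) ^ 2 := by
          field_simp; ring
        have h3 : 0 ≤ (1 - δ) / δ * (δ * a m - b m) ^ 2 :=
          mul_nonneg (div_nonneg (by linarith) hδ.le) (sq_nonneg _)
        linarith
      nlinarith
  have h1 : 0 ≤ (1 - δ) * a m ^ 2 := mul_nonneg (by linarith) (sq_nonneg _)
  have h2 : a 0 ^ 2 / δ + (∑ k ∈ Finset.range m, b k ^ 2) / δ ^ 2
      = (a 0 ^ 2 + (∑ k ∈ Finset.range m, b k ^ 2) / δ) / δ := by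
    field_simp
  rw [h2, le_div_iff₀ hδ]
  linarith

/-- The bound of `sum_sq_le_of_contract` with linearly growing weights. -/
lemma sum_weighted_sq_le_of_contract {δ β : ℝ} (hδ : 0 < δ) (hδ1 : δ ≤ 1 / 2)
    (hβ : 0 ≤ β) (hβ1 : β ≤ 1 / 4) {w : ℕ → ℝ} (hw0 : 0 < w 0)
    (hw : ∀ k, w k = w 0 * (1 + β * k)) {a b : ℕ → ℝ}
    (ha : ∀ k, 0 ≤ a k) (h : ∀ k, a (k + 1) ≤ (1 - δ) * a k + b k) (m : ℕ) :
    ∑ k ∈ Finset.range (m + 1), w k ^ 2 * a k ^ 2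
      ≤ 3 / (8 * δ ^ 3) * (w 0 ^ 2 * a 0 ^ 2)
        + 5 / (8 * δ ^ 4) * ∑ k ∈ Finset.range m, w k ^ 2 * b k ^ 2 := by
  have hwge : ∀ k, w 0 ≤ w k := fun k => by
    rw [hw k]; nlinarith [mul_nonneg hβ (Nat.cast_nonneg (α := ℝ) k)]
  have hws : ∀ k, w (k + 1) = w k + β * w 0 := fun k => by
    rw [hw (k + 1), hw k]; push_cast; ring
  -- The weight grows by `β * w 0` per step. This increment times `a (k + 1)` is treated as
  -- additional input, whose square sum the unweighted bound `h0` controls.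
  have hA := sum_sq_le_of_contract hδ (by linarith) (a := fun k => w k * a k)
    (b := fun k => w k * b k + β * w 0 * a (k + 1))
    (fun k => mul_nonneg (hw0.le.trans (hwge k)) (ha k))
    (fun k => by
      have := mul_le_mul_of_nonneg_left (h k) (hw0.le.trans (hwge k))
      simp only [hws]; nlinarith) m
  have h0 := sum_sq_le_of_contract hδ (by linarith) ha h m
  set B := ∑ k ∈ Finset.range m, w k ^ 2 * b k ^ 2 with hB
  have hB0 : 0 ≤ B := Finset.sum_nonneg fun k _ => by positivity
  have hb : w 0 ^ 2 * ∑ k ∈ Finset.range m, b k ^ 2 ≤ B := by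
    rw [hB, Finset.mul_sum]
    gcongr with k _
    exact hwge k
  have ha1 : ∑ k ∈ Finset.range m, a (k + 1) ^ 2 ≤ ∑ k ∈ Finset.range (m + 1), a k ^ 2 := by
    rw [Finset.sum_range_succ' (fun k => a k ^ 2)]
    nlinarith [sq_nonneg (a 0)]
  have hin : ∑ k ∈ Finset.range m, (w k * b k + β * w 0 * a (k + 1)) ^ 2
      ≤ 2 * B + 2 * (β ^ 2 * w 0 ^ 2) * ∑ k ∈ Finset.range m, a (k + 1) ^ 2 := by
    rw [hB, Finset.mul_sum, Finset.mul_sum, ← Finset.sum_add_distrib]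
    refine Finset.sum_le_sum fun k _ => ?_
    nlinarith [sq_nonneg (w k * b k - β * w 0 * a (k + 1))]
  set A := w 0 ^ 2 * a 0 ^ 2 with hA'
  have hA0 : 0 ≤ A := by positivity
  have h1 : w 0 ^ 2 * ∑ k ∈ Finset.range m, a (k + 1) ^ 2 ≤ A / δ + B / δ ^ 2 := by
    calc _ ≤ w 0 ^ 2 * (a 0 ^ 2 / δ + (∑ k ∈ Finset.range m, b k ^ 2) / δ ^ 2) := by
          gcongr; exact ha1.trans h0
      _ = A / δ + (w 0 ^ 2 * ∑ k ∈ Finset.range m, b k ^ 2) / δ ^ 2 := by rw [hA']; ring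
      _ ≤ _ := by gcongr
  have hβ2 : β ^ 2 ≤ 1 / 16 := by nlinarith
  have h2 : ∑ k ∈ Finset.range m, (w k * b k + β * w 0 * a (k + 1)) ^ 2
      ≤ 2 * B + 1 / 8 * (A / δ + B / δ ^ 2) := by
    refine hin.trans ?_
    have : 0 ≤ w 0 ^ 2 * ∑ k ∈ Finset.range m, a (k + 1) ^ 2 := by positivity
    nlinarith
  have h3 : ∑ k ∈ Finset.range (m + 1), (w k * a k) ^ 2
      ≤ A / δ + (2 * B + 1 / 8 * (A / δ + B / δ ^ 2)) / δ ^ 2 := by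
    refine hA.trans ?_
    rw [mul_pow, ← hA']
    gcongr
  simp only [mul_pow] at h3
  refine h3.trans ?_
  have e1 : A / δ + (2 * B + 1 / 8 * (A / δ + B / δ ^ 2)) / δ ^ 2
      = (δ ^ 2 + 1 / 8) / δ ^ 3 * A + (2 * δ ^ 2 + 1 / 8) / δ ^ 4 * B := by
    field_simp; ring
  have e2 : 3 / (8 * δ ^ 3) * A + 5 / (8 * δ ^ 4) * B
      = (3 / 8) / δ ^ 3 * A + (5 / 8) / δ ^ 4 * B := by
    field_simp
  rw [e1, e2]
  have hδ2 : δ ^ 2 ≤ 1 / 4 := by nlinarith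
  gcongr <;> linarith


open Matrix

/-! ### Regular column stochastic matrices -/

section Perron

variable {n : ℕ} {C : Matrix (Fin n) (Fin n) ℝ}

lemma exists_forall_le_of_pos (D : Matrix (Fin n) (Fin n) ℝ) (hD : ∀ i j, 0 < D i j) :
    ∃ ε > 0, ∀ i j, ε ≤ D i j := by
  rcases isEmpty_or_nonempty (Fin n) with h | h
  · exact ⟨1, one_pos, fun i => h.elim i⟩
  · obtain ⟨⟨i₀, j₀⟩, h₀⟩ := Finite.exists_min (fun ij : Fin n × Fin n => D ij.1 ij.2)
    exact ⟨D i₀ j₀, hD _ _, fun i j => h₀ (i, j)⟩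

/-- A column stochastic matrix with entries at least `ε` contracts the `ℓ¹` norm of vectors
with zero sum. -/
lemma sum_norm_smul_le_of_sum_eq_zero {E : Type*} [NormedAddCommGroup E] [NormedSpace ℝ E]
    {D : Matrix (Fin n) (Fin n) ℝ} (hsum : ∀ j, ∑ i, D i j = 1) {ε : ℝ}
    (hε : ∀ i j, ε ≤ D i j) {u : Fin n → E} (hu : ∑ j, u j = 0) :
    ∑ i, ‖∑ j, D i j • u j‖ ≤ (1 - n * ε) * ∑ j, ‖u j‖ := by
  -- On zero-sum vectors a constant may be subtracted from each row; the entries stay nonnegative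
  -- and the column sums drop to 1 - nε.
  have h1 : ∀ i, ∑ j, D i j • u j = ∑ j, (D i j - ε) • u j := fun i => by
    simp [sub_smul, Finset.sum_sub_distrib, ← Finset.smul_sum, hu]
  calc ∑ i, ‖∑ j, D i j • u j‖ ≤ ∑ i, ∑ j, (D i j - ε) * ‖u j‖ := by
        refine Finset.sum_le_sum fun i _ => ?_
        rw [h1]
        refine (norm_sum_le _ _).trans (Finset.sum_le_sum fun j _ => ?_)
        rw [norm_smul, Real.norm_of_nonneg (sub_nonneg.2 (hε i j))]
    _ = ∑ j, (∑ i, (D i j - ε)) * ‖u j‖ := by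
        rw [Finset.sum_comm]; simp_rw [Finset.sum_mul]
    _ = _ := by simp [Finset.sum_sub_distrib, hsum, Finset.mul_sum]

/-- Some power of a regular column stochastic matrix contracts zero-sum vectors in `ℓ¹`. -/
lemma IsRegularColStochastic.exists_contraction (hn : 0 < n) (hC : IsRegularColStochastic C) :
    ∃ (l : ℕ) (r : ℝ), r < 1 ∧ ∀ {E : Type} [NormedAddCommGroup E] [NormedSpace ℝ E]
      (u : Fin n → E), ∑ j, u j = 0 → ∑ i, ‖∑ j, (C ^ l) i j • u j‖ ≤ r * ∑ j, ‖u j‖ := by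
  obtain ⟨l, hl⟩ := hC.regular
  obtain ⟨ε, hε, h⟩ := exists_forall_le_of_pos _ hl
  refine ⟨l, 1 - n * ε, ?_, fun u hu => ?_⟩
  · have : (0 : ℝ) < n * ε := by positivity
    linarith
  · exact sum_norm_smul_le_of_sum_eq_zero
      (mem_colStochastic_iff_sum.1 (pow_mem hC.colStochastic l)).2 h hu

lemma pow_mulVec_of_eigen {R : Type*} [CommRing R] {A : Matrix (Fin n) (Fin n) R}
    {w : Fin n → R} {c : R} (h : A *ᵥ w = c • w) (k : ℕ) : (A ^ k) *ᵥ w = c ^ k • w := by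
  induction k with
  | zero => simp
  | succ k ih => rw [pow_succ, ← mulVec_mulVec, h, mulVec_smul, ih, smul_smul, pow_succ, mul_comm]

lemma pow_mulVec_of_fixed {w : Fin n → ℝ} (h : C *ᵥ w = w) (k : ℕ) : (C ^ k) *ᵥ w = w := by
  simpa using pow_mulVec_of_eigen (c := (1 : ℝ)) (by simpa using h) k

/-- A fixed vector is also fixed by the contracting power, so its ℓ¹ norm is at most r < 1 times
itself. -/
lemma eq_zero_of_fixed (hn : 0 < n) (hC : IsRegularColStochastic C) {u : Fin n → ℝ}
    (hu : C *ᵥ u = u) (hs : ∑ j, u j = 0) : u = 0 := by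
  obtain ⟨l, r, hr, h⟩ := hC.exists_contraction hn
  have h1 : (C ^ l) *ᵥ u = u := pow_mulVec_of_fixed hu l
  have h2 := h u hs
  have h3 : ∀ i, ∑ j, (C ^ l) i j • u j = u i := fun i => congrFun h1 i
  simp only [h3] at h2
  have h0 : 0 ≤ ∑ j, ‖u j‖ := Finset.sum_nonneg fun _ _ => norm_nonneg _
  have h4 : ∑ j, ‖u j‖ = 0 := by nlinarith
  rw [Finset.sum_eq_zero_iff_of_nonneg fun _ _ => norm_nonneg _] at h4
  funext j
  simpa using h4 j (Finset.mem_univ _)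

/-- A column stochastic matrix has a nonnegative nonzero fixed vector. -/
lemma exists_nonneg_fixed (hn : 0 < n) (hC : C ∈ colStochastic ℝ (Fin n)) :
    ∃ q : Fin n → ℝ, q ≠ 0 ∧ (∀ i, 0 ≤ q i) ∧ C *ᵥ q = q := by
  have : Nonempty (Fin n) := ⟨⟨0, hn⟩⟩
  -- The all-ones row vector is a left null vector of `C - 1`.
  have hd : (C - 1).det = 0 := by
    rw [← exists_vecMul_eq_zero_iff]
    refine ⟨1, one_ne_zero, ?_⟩
    rw [vecMul_sub, one_vecMul_of_mem_colStochastic hC, vecMul_one, sub_self]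
  obtain ⟨u, hu0, hu⟩ := exists_mulVec_eq_zero_iff.2 hd
  have hu' : C *ᵥ u = u := by
    rwa [sub_mulVec, one_mulVec, sub_eq_zero] at hu
  have hle : ∀ i, |u i| ≤ (C *ᵥ fun j => |u j|) i := fun i => by
    conv_lhs => rw [← hu']
    refine (Finset.abs_sum_le_sum_abs (fun j => C i j * u j) Finset.univ).trans_eq ?_
    refine Finset.sum_congr rfl fun j _ => ?_
    rw [abs_mul, abs_of_nonneg (nonneg_of_mem_colStochastic hC)]
  -- |u| ≤ C|u| entrywise, while both sides have the same total because columns sum to 1; hence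
  -- equality holds in every entry.
  have heq := (Finset.sum_eq_sum_iff_of_le (s := Finset.univ) fun i _ => hle i).1
    (sum_mulVec_of_mem_colStochastic hC).symm
  refine ⟨fun j => |u j|, fun h => hu0 ?_, fun _ => abs_nonneg _, ?_⟩
  · funext j; simpa using congrFun h j
  · funext i; exact (heq i (Finset.mem_univ _)).symm

lemma existsUnique_perron (hn : 0 < n) (hC : IsRegularColStochastic C) :
    ∃! p : Fin n → ℝ, IsPerronVector C p := by
  obtain ⟨q, hq0, hq, hCq⟩ := exists_nonneg_fixed hn hC.colStochastic
  obtain ⟨l, hl⟩ := hC.regular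
  have hne : ∃ j, q j ≠ 0 := by
    by_contra! h; exact hq0 (funext h)
  obtain ⟨j, hj⟩ := hne
  have hfix : (C ^ l) *ᵥ q = q := pow_mulVec_of_fixed hCq l
  have hpos : ∀ i, 0 < q i := fun i => by
    rw [← hfix]
    exact Finset.sum_pos' (fun k _ => mul_nonneg (hl i k).le (hq k))
      ⟨j, Finset.mem_univ _, mul_pos (hl i j) ((hq j).lt_of_ne' hj)⟩
  have hs : 0 < ∑ i, q i :=
    Finset.sum_pos (fun i _ => hpos i) ⟨⟨0, hn⟩, Finset.mem_univ _⟩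
  have hn' : (0 : ℝ) < n := by exact_mod_cast hn
  refine ⟨((n : ℝ) / ∑ i, q i) • q, ⟨fun i => ?_, ?_, ?_⟩, fun p hp => ?_⟩
  · exact mul_pos (div_pos hn' hs) (hpos i)
  · rw [mulVec_smul, hCq]
  · simp only [Pi.smul_apply, smul_eq_mul, ← Finset.mul_sum]
    field_simp
  · rw [← sub_eq_zero]
    refine eq_zero_of_fixed hn hC ?_ ?_
    · rw [mulVec_sub, mulVec_smul, hCq, hp.eigen]
    · simp only [Pi.sub_apply, Finset.sum_sub_distrib, hp.sum_eq, Pi.smul_apply, smul_eq_mul,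
        ← Finset.mul_sum]
      field_simp
      ring

lemma perronProj_apply (p : Fin n → ℝ) (i j : Fin n) : perronProj p i j = p i / n := by
  simp [perronProj]; ring

lemma sum_perronProj (hn : 0 < n) {p : Fin n → ℝ} (hp : ∑ i, p i = n) (j : Fin n) :
    ∑ i, perronProj p i j = 1 := by
  have hn' : (n : ℝ) ≠ 0 := by exact_mod_cast hn.ne'
  simp only [perronProj_apply, ← Finset.sum_div, hp]
  field_simp

/-- `C - p 1ᵀ / n` has spectral radius less than one. -/
lemma mixRadius_lt_one (hn : 0 < n) (hC : IsRegularColStochastic C) {p : Fin n → ℝ}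
    (hp : IsPerronVector C p) : mixRadius C p < 1 := by
  have : Nonempty (Fin n) := ⟨⟨0, hn⟩⟩
  obtain ⟨l, r, hr, h⟩ := hC.exists_contraction hn
  open scoped Matrix.Norms.L2Operator in
  refine spectrum.spectralRadius_lt_of_forall_lt (r := 1) _ fun z hz => ?_
  rw [← NNReal.coe_lt_coe, coe_nnnorm, NNReal.coe_one]
  set M : Matrix (Fin n) (Fin n) ℂ := (C - perronProj p).map (algebraMap ℝ ℂ) with hM
  rw [spectrum.mem_iff, isUnit_iff_isUnit_det, isUnit_iff_ne_zero, not_not,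
    ← exists_mulVec_eq_zero_iff] at hz
  obtain ⟨w, hw0, hw⟩ := hz
  have hw' : M *ᵥ w = z • w := by
    rw [sub_mulVec, Algebra.algebraMap_eq_smul_one, smul_mulVec, one_mulVec, sub_eq_zero] at hw
    exact hw.symm
  -- For z ≠ 0 the vanishing column sums of `M` force the eigenvector to have zero sum. Then the
  -- Perron part kills it, it is an eigenvector of `C` as well, and the contracting power bounds
  -- ‖z‖^l by r.
  by_cases hz0 : z = 0
  · simp [hz0]
  have hcol : ∀ j, ∑ i, M i j = 0 := fun j => by
    have : ∑ i, (C - perronProj p) i j = 0 := by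
      simp [Finset.sum_sub_distrib, sum_perronProj hn hp.sum_eq,
        sum_col_of_mem_colStochastic hC.colStochastic]
    simp only [hM, map_apply]
    rw [← map_sum, this, map_zero]
  have hs : ∑ j, w j = 0 := by
    have h1 : ∑ i, (M *ᵥ w) i = 0 := by
      simp only [mulVec, dotProduct]
      rw [Finset.sum_comm]
      simp [← Finset.sum_mul, hcol]
    rw [hw'] at h1
    simpa [← Finset.mul_sum, hz0] using h1
  have hCw : (C.map (algebraMap ℝ ℂ)) *ᵥ w = z • w := by
    rw [← hw', hM, Matrix.map_sub _ (by simp), sub_mulVec]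
    have : ((perronProj p).map (algebraMap ℝ ℂ)) *ᵥ w = 0 := by
      funext i
      simp [mulVec, dotProduct, perronProj_apply, ← Finset.mul_sum, hs]
    rw [this, sub_zero]
  have hpow : ∀ i, ∑ j, (C ^ l) i j • w j = z ^ l * w i := fun i => by
    have h1 := congrFun (pow_mulVec_of_eigen hCw l) i
    rw [← Matrix.map_pow] at h1
    simpa [mulVec, dotProduct, Complex.real_smul] using h1
  have h2 := h w hs
  simp only [hpow, norm_mul, norm_pow, ← Finset.mul_sum] at h2
  have hpos : 0 < ∑ j, ‖w j‖ := by
    refine lt_of_le_of_ne (Finset.sum_nonneg fun _ _ => norm_nonneg _) fun h0 => hw0 ?_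
    have := (Finset.sum_eq_zero_iff_of_nonneg fun _ _ => norm_nonneg _).1 h0.symm
    funext j
    simpa using this j (Finset.mem_univ _)
  have h3 : ‖z‖ ^ l ≤ r := le_of_mul_le_mul_right h2 hpos
  by_contra! h4
  linarith [one_le_pow₀ h4 (n := l)]

/-- The weights stay bounded away from zero: `v_{k,i}⁻¹ ≤ ν`. -/
lemma iterate_pos_and_inv_le (hC : IsRegularColStochastic C) {p : Fin n → ℝ}
    (hp : IsPerronVector C p) {v₀ : Fin n → ℝ} (hv : ∀ i, 0 < v₀ i) (k : ℕ) (i : Fin n) :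
    0 < ((C ^ k) *ᵥ v₀) i ∧ (((C ^ k) *ᵥ v₀) i)⁻¹ ≤ vInvBound C v₀ := by
  have : Nonempty (Fin n) := ⟨i⟩
  obtain ⟨i₁, h₁⟩ := Finite.exists_min (fun j => v₀ j / p j)
  obtain ⟨i₂, h₂⟩ := Finite.exists_min p
  set c := v₀ i₁ / p i₁
  have hc : 0 < c := div_pos (hv _) (hp.pos _)
  -- The comparison c p ≤ v₀ is preserved by the nonnegative powers of `C`, which fix `p`.
  have hlow : ∀ (k : ℕ) (j : Fin n), c * p i₂ ≤ ((C ^ k) *ᵥ v₀) j := fun k j => by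
    have hfix : (C ^ k) *ᵥ p = p := pow_mulVec_of_fixed hp.eigen k
    calc c * p i₂ ≤ c * p j := by gcongr; exact h₂ j
      _ = ((C ^ k) *ᵥ (c • p)) j := by rw [mulVec_smul, hfix]; rfl
      _ ≤ _ := by
          simp only [mulVec, dotProduct]
          refine Finset.sum_le_sum fun m _ => mul_le_mul_of_nonneg_left ?_
            (nonneg_of_mem_colStochastic (pow_mem hC.colStochastic k))
          have := h₁ m
          rw [le_div_iff₀ (hp.pos m)] at this
          exact this
  have hpos : 0 < c * p i₂ := mul_pos hc (hp.pos _)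
  have hbdd : BddBelow (Set.range fun ki : ℕ × Fin n => ((C ^ ki.1) *ᵥ v₀) ki.2) :=
    ⟨c * p i₂, by rintro _ ⟨ki, rfl⟩; exact hlow _ _⟩
  have hinf : c * p i₂ ≤ ⨅ ki : ℕ × Fin n, ((C ^ ki.1) *ᵥ v₀) ki.2 :=
    le_ciInf fun ki => hlow _ _
  exact ⟨hpos.trans_le (hlow k i), inv_anti₀ (hpos.trans_le hinf) (ciInf_le hbdd (k, i))⟩

end Perron


open Matrix

/-! ### Norms adapted to the mixing matrix -/

section Norms

variable {n : ℕ}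

lemma euclNorm_nonneg (x : Fin n → ℝ) : 0 ≤ euclNorm x := norm_nonneg _

lemma euclNorm_sq (x : Fin n → ℝ) : euclNorm x ^ 2 = ∑ i, x i ^ 2 := by
  simp [euclNorm, EuclideanSpace.norm_sq_eq]

lemma euclNorm_eq_zero {x : Fin n → ℝ} : euclNorm x = 0 ↔ x = 0 := by
  simp [euclNorm]

lemma euclNorm_smul (c : ℝ) (x : Fin n → ℝ) : euclNorm (c • x) = |c| * euclNorm x := by
  simp [euclNorm, norm_smul]

/-- An operator bound for matrices with respect to the Euclidean norm. -/
lemma exists_euclNorm_mulVec_le (A : Matrix (Fin n) (Fin n) ℝ) :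
    ∃ K, 0 ≤ K ∧ ∀ x, euclNorm (A *ᵥ x) ≤ K * euclNorm x := by
  open scoped Matrix.Norms.L2Operator in
  exact ⟨‖A‖, norm_nonneg _, fun x => Matrix.l2_opNorm_mulVec A (WithLp.toLp 2 x)⟩

lemma vecNorm_nonneg (Ct : Matrix (Fin n) (Fin n) ℝ) (x : Fin n → ℝ) : 0 ≤ vecNorm Ct x :=
  norm_nonneg _

/-- The sum of the forms AᵀA is positive semidefinite and factors as BᵀB. This is what lets a norm
built from several seminorms be written with a single matrix. -/
lemma exists_vecNorm_eq_sum {ι : Type*} (s : Finset ι) (A : ι → Matrix (Fin n) (Fin n) ℝ) :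
    ∃ B : Matrix (Fin n) (Fin n) ℝ, ∀ x, vecNorm B x ^ 2 = ∑ j ∈ s, euclNorm (A j *ᵥ x) ^ 2 := by
  have hsq : ∀ (M : Matrix (Fin n) (Fin n) ℝ) x,
      euclNorm (M *ᵥ x) ^ 2 = x ⬝ᵥ ((Mᵀ * M) *ᵥ x) := fun M x => by
    rw [← mulVec_mulVec, dotProduct_mulVec, vecMul_transpose, euclNorm_sq]
    simp [dotProduct, sq]
  have hps : (∑ j ∈ s, (A j)ᵀ * A j).PosSemidef := by
    refine Matrix.posSemidef_sum s fun j _ => ?_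
    simpa using Matrix.posSemidef_conjTranspose_mul_self (A j)
  obtain ⟨B, hB⟩ : ∃ B : Matrix (Fin n) (Fin n) ℝ, ∑ j ∈ s, (A j)ᵀ * A j = Bᵀ * B := by
    open scoped Matrix.Norms.L2Operator ComplexOrder MatrixOrder in
    simpa [star_eq_conjTranspose] using CStarAlgebra.nonneg_iff_eq_star_mul_self.mp hps.nonneg
  refine ⟨B, fun x => ?_⟩
  rw [vecNorm, hsq, ← hB, Matrix.sum_mulVec, dotProduct_sum]
  simp [hsq]

/-- Gelfand's formula for a real matrix, in terms of the Euclidean norm. -/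
lemma exists_pow_euclNorm_le {M : Matrix (Fin n) (Fin n) ℝ} {ρ : ℝ}
    (h : spectralRadius ℂ (M.map (algebraMap ℝ ℂ)) < ENNReal.ofReal ρ) :
    ∃ N : ℕ, 0 < N ∧ ∀ x, euclNorm ((M ^ N) *ᵥ x) ≤ ρ ^ N * euclNorm x := by
  have hρ : 0 < ρ := by
    by_contra! h0
    rw [ENNReal.ofReal_of_nonpos h0] at h
    exact not_lt_zero h
  open scoped Matrix.Norms.L2Operator in
  have ht := spectrum.pow_nnnorm_pow_one_div_tendsto_nhds_spectralRadius
    (M.map (algebraMap ℝ ℂ))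
  obtain ⟨N, hN, hN0⟩ := ((ht.eventually_lt_const h).and
    (Filter.eventually_gt_atTop 0)).exists
  refine ⟨N, hN0, fun x => ?_⟩
  open scoped Matrix.Norms.L2Operator in
  have h1 : ‖(M.map (algebraMap ℝ ℂ)) ^ N‖ ≤ ρ ^ N := by
    have h2 := ENNReal.rpow_le_rpow hN.le (z := N) (by positivity)
    rw [← ENNReal.rpow_mul, one_div, inv_mul_cancel₀ (by positivity), ENNReal.rpow_one,
      ENNReal.rpow_natCast, ← ENNReal.ofReal_pow hρ.le] at h2
    have h3 := ENNReal.toReal_mono ENNReal.ofReal_ne_top h2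
    rwa [ENNReal.toReal_ofReal (by positivity)] at h3
  open scoped Matrix.Norms.L2Operator in
  have h2 := Matrix.l2_opNorm_mulVec ((M.map (algebraMap ℝ ℂ)) ^ N)
    (WithLp.toLp 2 (fun i => (x i : ℂ)))
  have hc : ∀ y : Fin n → ℝ, ‖(WithLp.toLp 2 (fun i => (y i : ℂ)) : EuclideanSpace ℂ (Fin n))‖
      = euclNorm y := fun y => by
    simp [euclNorm, EuclideanSpace.norm_eq]
  have hm : ((M.map (algebraMap ℝ ℂ)) ^ N) *ᵥ (fun i => (x i : ℂ))
      = fun i => (((M ^ N) *ᵥ x) i : ℂ) := by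
    rw [← Matrix.map_pow]
    funext i
    simp [mulVec, dotProduct]
  rw [hc] at h2
  simp only [hm] at h2
  rw [← hc ((M ^ N) *ᵥ x)]
  exact h2.trans (mul_le_mul_of_nonneg_right h1 (euclNorm_nonneg x))

/-! ### Algebra of the Perron projection and its complement -/

section Projection

variable {C : Matrix (Fin n) (Fin n) ℝ} {p : Fin n → ℝ}

lemma perronProj_mul_self (hn : 0 < n) (hp : ∑ i, p i = n) :
    perronProj p * perronProj p = perronProj p := by
  ext i j
  simp only [mul_apply]
  simp_rw [perronProj_apply p i, ← Finset.mul_sum, sum_perronProj hn hp, mul_one]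

lemma mul_perronProj (hp : C *ᵥ p = p) : C * perronProj p = perronProj p := by
  rw [perronProj, Matrix.mul_smul, mul_vecMulVec, hp]

lemma perronProj_mul (hC : C ∈ colStochastic ℝ (Fin n)) : perronProj p * C = perronProj p := by
  rw [perronProj, Matrix.smul_mul, vecMulVec_mul, one_vecMul_of_mem_colStochastic hC]

lemma conMat_mul_mix (hC : C ∈ colStochastic ℝ (Fin n)) :
    conMat p * C = C - perronProj p := by
  rw [conMat, sub_mul, one_mul, perronProj_mul hC]

/-- Moving Π past `C` replaces `C` by the matrix whose adapted norm is at most 1 - δ, so mixing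
contracts consensus errors. -/
lemma conMat_mul (hn : 0 < n) (hC : C ∈ colStochastic ℝ (Fin n)) (hp : IsPerronVector C p) :
    conMat p * C = (C - perronProj p) * conMat p := by
  rw [conMat_mul_mix hC, conMat, mul_sub, mul_one, sub_mul, mul_perronProj hp.eigen,
    perronProj_mul_self hn hp.sum_eq, sub_self, sub_zero]

lemma conMat_mul_self (hn : 0 < n) (hp : ∑ i, p i = n) : conMat p * conMat p = conMat p := by
  simp [conMat, mul_sub, sub_mul, perronProj_mul_self hn hp]

lemma perronProj_mul_conMat (hn : 0 < n) (hp : ∑ i, p i = n) :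
    perronProj p * conMat p = 0 := by
  simp [conMat, mul_sub, perronProj_mul_self hn hp]

end Projection

lemma inducedNorm_le (hn : 0 < n) {Ct A : Matrix (Fin n) (Fin n) ℝ} {r : ℝ} (hr : 0 ≤ r)
    (h : ∀ x, vecNorm Ct (A *ᵥ x) ≤ r * vecNorm Ct x) : inducedNorm Ct A ≤ r := by
  have : Nonempty (Fin n) := ⟨⟨0, hn⟩⟩
  have : Nonempty {x : Fin n → ℝ // x ≠ 0} := ⟨⟨1, one_ne_zero⟩⟩
  exact ciSup_le fun x => div_le_of_le_mul₀ (vecNorm_nonneg _ _) hr (h x)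

/-- Adapted norms exist for every admissible gap `δ`. -/
lemma exists_isAdaptedNorm (hn : 0 < n) {C : Matrix (Fin n) (Fin n) ℝ}
    (hC : C ∈ colStochastic ℝ (Fin n)) {p : Fin n → ℝ} (hp : IsPerronVector C p) {δ : ℝ}
    (hδ : 0 < δ) (h : ENNReal.ofReal δ < 1 - mixRadius C p) :
    ∃ (Ct : Matrix (Fin n) (Fin n) ℝ) (κ : ℝ), IsAdaptedNorm C p δ Ct κ := by
  set M := C - perronProj p with hM
  set Q := conMat p with hQ
  set ρ := 1 - δ with hρdef
  have hrad : spectralRadius ℂ (M.map (algebraMap ℝ ℂ)) < ENNReal.ofReal ρ := by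
    rw [hρdef, ENNReal.ofReal_sub _ hδ.le, ENNReal.ofReal_one]
    exact lt_tsub_comm.1 h
  have hρ : 0 < ρ := by
    by_contra! h0
    rw [ENNReal.ofReal_of_nonpos h0] at hrad
    exact not_lt_zero hrad
  obtain ⟨N, hN0, hN⟩ := exists_pow_euclNorm_le hrad
  have hMQ : M * Q = Q * M := by
    have h1 : Q * C = M := conMat_mul_mix hC
    have h2 : Q * C = M * Q := conMat_mul hn hC hp
    have h3 : perronProj p * M = 0 := by
      rw [hM, mul_sub, perronProj_mul hC, perronProj_mul_self hn hp.sum_eq, sub_self]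
    rw [← h2, h1, hQ, conMat, sub_mul, h3, one_mul, sub_zero]
  have hPM : perronProj p * M = 0 := by
    rw [hM, mul_sub, perronProj_mul hC, perronProj_mul_self hn hp.sum_eq, sub_self]
  -- the family of matrices whose quadratic forms are added up
  obtain ⟨B, hB⟩ := exists_vecNorm_eq_sum (Finset.range (N + 1)) (fun j => match j with
    | 0 => perronProj p
    | k + 1 => (ρ⁻¹ ^ k) • (M ^ k * Q))
  replace hB : ∀ x, vecNorm B x ^ 2 = (∑ k ∈ Finset.range N,
      (ρ⁻¹ ^ k) ^ 2 * euclNorm ((M ^ k) *ᵥ (Q *ᵥ x)) ^ 2) + euclNorm (perronProj p *ᵥ x) ^ 2 :=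
    fun x => by
      rw [hB, Finset.sum_range_succ']
      simp [smul_mulVec, euclNorm_smul, mul_pow, mulVec_mulVec, abs_of_pos hρ]
  have hQQ : ∀ x, Q *ᵥ (Q *ᵥ x) = Q *ᵥ x := fun x => by
    rw [mulVec_mulVec, conMat_mul_self hn hp.sum_eq]
  have hQproj : ∀ x, vecNorm B (Q *ᵥ x) ≤ vecNorm B x := fun x => by
    refine le_of_sq_le_sq ?_ (vecNorm_nonneg _ _)
    rw [hB, hB, hQQ, mulVec_mulVec, perronProj_mul_conMat hn hp.sum_eq]
    simp only [zero_mulVec, euclNorm_eq_zero.2 rfl]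
    nlinarith [sq_nonneg (euclNorm (perronProj p *ᵥ x))]
  have hMcontr : ∀ x, vecNorm B (M *ᵥ x) ≤ ρ * vecNorm B x := fun x => by
    refine le_of_sq_le_sq ?_ (mul_nonneg hρ.le (vecNorm_nonneg _ _))
    rw [mul_pow, hB, hB, mulVec_mulVec x (perronProj p) M, hPM]
    simp only [zero_mulVec, euclNorm_eq_zero.2 rfl]
    set F : ℕ → ℝ := fun k => (ρ⁻¹ ^ k) ^ 2 * euclNorm ((M ^ k) *ᵥ (Q *ᵥ x)) ^ 2 with hF
    have e1 : ∀ k, (ρ⁻¹ ^ k) ^ 2 * euclNorm ((M ^ k) *ᵥ (Q *ᵥ (M *ᵥ x))) ^ 2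
        = ρ ^ 2 * F (k + 1) := fun k => by
      have : (M ^ k) *ᵥ (Q *ᵥ (M *ᵥ x)) = (M ^ (k + 1)) *ᵥ (Q *ᵥ x) := by
        simp only [mulVec_mulVec, pow_succ, mul_assoc, hMQ]
      rw [this, hF]
      simp only [inv_pow]
      field_simp
      ring
    simp only [e1, ← Finset.mul_sum]
    -- Up to the factor ρ², replacing x by Mx shifts the index of the sum by one. The sum then
    -- changes by F N - F 0, which is nonpositive by the choice of N.
    have e2 : ∑ k ∈ Finset.range N, F (k + 1) + F 0 = ∑ k ∈ Finset.range N, F k + F N := by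
      rw [← Finset.sum_range_succ', Finset.sum_range_succ]
    have e3 : F N ≤ F 0 := by
      simp only [hF, pow_zero, one_pow, one_mul, one_mulVec]
      rw [← mul_pow]
      refine pow_le_pow_left₀ (mul_nonneg (by positivity) (euclNorm_nonneg _)) ?_ 2
      rw [inv_pow, inv_mul_le_iff₀ (by positivity)]
      exact hN _
    have e4 := sq_nonneg (euclNorm (perronProj p *ᵥ x))
    have e5 : ρ ^ 2 * ∑ k ∈ Finset.range N, F (k + 1)
        ≤ ρ ^ 2 * (∑ k ∈ Finset.range N, F k + euclNorm (perronProj p *ᵥ x) ^ 2) := by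
      gcongr
      linarith
    linarith
  -- The forms include ‖Qx‖² (the term k = 0, present because N > 0) and the squared norm of the
  -- Perron part; if both vanish, so does x.
  have hBu : IsUnit B := by
    rw [← mulVec_injective_iff_isUnit]
    refine (injective_iff_map_eq_zero (Matrix.mulVecLin B)).2 fun x hx => ?_
    have h0 : vecNorm B x ^ 2 = 0 := by
      rw [vecNorm, show B *ᵥ x = 0 from hx, euclNorm_eq_zero.2 rfl]; norm_num
    have h1 : ∀ k, 0 ≤ (ρ⁻¹ ^ k) ^ 2 * euclNorm ((M ^ k) *ᵥ (Q *ᵥ x)) ^ 2 := fun k => by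
      positivity
    rw [hB] at h0
    have h2 := sq_nonneg (euclNorm (perronProj p *ᵥ x))
    have h3 : euclNorm (perronProj p *ᵥ x) ^ 2 = 0 :=
      le_antisymm (by linarith [Finset.sum_nonneg fun k (_ : k ∈ Finset.range N) => h1 k]) h2
    have h4 := (Finset.single_le_sum (fun k _ => h1 k) (Finset.mem_range.2 hN0)).trans
      (le_of_eq (by linarith : _ = (0 : ℝ)))
    have h5 : euclNorm (Q *ᵥ x) ^ 2 = 0 := le_antisymm (by simpa using h4) (sq_nonneg _)
    have h6 := euclNorm_eq_zero.1 (pow_eq_zero_iff two_ne_zero |>.1 h3)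
    have h7 := euclNorm_eq_zero.1 (pow_eq_zero_iff two_ne_zero |>.1 h5)
    rw [hQ, conMat, sub_mulVec, h6, one_mulVec, sub_zero] at h7
    exact h7
  obtain ⟨K, hK0, hK⟩ := exists_euclNorm_mulVec_le B
  obtain ⟨K', hK'0, hK'⟩ := exists_euclNorm_mulVec_le B⁻¹
  -- Rescaling does not affect induced norms and puts the new norm below the Euclidean one; the `+
  -- 1` covers K = 0.
  set s := (K + 1)⁻¹ with hs
  have hs0 : 0 < s := by positivity
  have hscale : ∀ x, vecNorm (s • B) x = s * vecNorm B x := fun x => by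
    rw [vecNorm, smul_mulVec, euclNorm_smul, abs_of_pos hs0, vecNorm]
  refine ⟨s • B, max 1 (K' * s⁻¹), ?_, le_max_left _ _, fun x => ?_, fun x => ?_, ?_, ?_⟩
  · exact (IsUnit.smul (Units.mk0 s hs0.ne') hBu : IsUnit ((Units.mk0 s hs0.ne') • B))
  · rw [hscale, hs, inv_mul_le_iff₀ (by positivity)]
    refine (hK x).trans ?_
    nlinarith [euclNorm_nonneg x]
  · have h1 : euclNorm x ≤ K' * vecNorm B x := by
      have := hK' (B *ᵥ x)
      rwa [mulVec_mulVec, nonsing_inv_mul _ ((isUnit_iff_isUnit_det _).1 hBu), one_mulVec] at this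
    calc euclNorm x ≤ K' * s⁻¹ * vecNorm (s • B) x := by
          rw [hscale]; field_simp; exact h1
      _ ≤ _ := mul_le_mul_of_nonneg_right (le_max_right _ _) (vecNorm_nonneg _ _)
  · refine inducedNorm_le hn hρ.le fun x => ?_
    rw [hscale, hscale]
    nlinarith [hMcontr x]
  · refine inducedNorm_le hn zero_le_one fun x => ?_
    rw [hscale, hscale]
    nlinarith [hQproj x]

/-- A real supremum bounds its terms only if the family is bounded above; here that follows from the
equivalence with the Euclidean norm. -/
lemma IsAdaptedNorm.mulVec_le {C Ct A : Matrix (Fin n) (Fin n) ℝ} {p : Fin n → ℝ} {δ κ r : ℝ}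
    (h : IsAdaptedNorm C p δ Ct κ) (hA : inducedNorm Ct A ≤ r) (x : Fin n → ℝ) :
    vecNorm Ct (A *ᵥ x) ≤ r * vecNorm Ct x := by
  have hκ : 0 < κ := one_pos.trans_le h.one_le
  have hpos : ∀ y : Fin n → ℝ, y ≠ 0 → 0 < vecNorm Ct y := fun y hy => by
    refine (vecNorm_nonneg _ _).lt_of_ne fun h0 => hy ?_
    have := h.eucl_le y
    rw [← h0, mul_zero] at this
    exact euclNorm_eq_zero.1 (le_antisymm this (euclNorm_nonneg y))
  by_cases hx : x = 0
  · simp [hx, vecNorm, euclNorm_eq_zero.2 rfl]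
  obtain ⟨K, hK0, hK⟩ := exists_euclNorm_mulVec_le A
  have hbdd : BddAbove (Set.range fun y : {x : Fin n → ℝ // x ≠ 0} =>
      vecNorm Ct (A *ᵥ y) / vecNorm Ct y) := by
    refine ⟨K * κ, ?_⟩
    rintro _ ⟨⟨y, hy⟩, rfl⟩
    rw [div_le_iff₀ (hpos y hy)]
    calc _ ≤ euclNorm (A *ᵥ y) := h.le_eucl _
      _ ≤ K * euclNorm y := hK y
      _ ≤ K * (κ * vecNorm Ct y) := by gcongr; exact h.eucl_le y
      _ = _ := by ring
  have := (le_ciSup hbdd ⟨x, hx⟩).trans hA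
  rwa [div_le_iff₀ (hpos x hx)] at this

end Norms


open Matrix

/-! ### Norms of stacked local variables -/

section RowMatrices

variable {n d : ℕ}

lemma euclNorm_add_le (x y : Fin n → ℝ) : euclNorm (x + y) ≤ euclNorm x + euclNorm y := by
  simpa [euclNorm] using norm_add_le (WithLp.toLp 2 x : EuclideanSpace ℝ (Fin n)) (WithLp.toLp 2 y)

lemma euclNorm_mono {x y : Fin n → ℝ} (hx : ∀ i, 0 ≤ x i) (h : ∀ i, x i ≤ y i) :
    euclNorm x ≤ euclNorm y := by
  refine le_of_sq_le_sq ?_ (euclNorm_nonneg _)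
  rw [euclNorm_sq, euclNorm_sq]
  exact Finset.sum_le_sum fun i _ => pow_le_pow_left₀ (hx i) (h i) 2

lemma vecNorm_add_le (Ct : Matrix (Fin n) (Fin n) ℝ) (x y : Fin n → ℝ) :
    vecNorm Ct (x + y) ≤ vecNorm Ct x + vecNorm Ct y := by
  rw [vecNorm, mulVec_add]; exact euclNorm_add_le _ _

lemma vecNorm_smul (Ct : Matrix (Fin n) (Fin n) ℝ) (c : ℝ) (x : Fin n → ℝ) :
    vecNorm Ct (c • x) = |c| * vecNorm Ct x := by
  rw [vecNorm, mulVec_smul, euclNorm_smul, vecNorm]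

lemma colNorm_nonneg (N : (Fin n → ℝ) → ℝ) (A : RowMat n d) : 0 ≤ colNorm N A :=
  euclNorm_nonneg _

lemma colNorm_le_mul {N N' : (Fin n → ℝ) → ℝ} {A B : RowMat n d} {c : ℝ} (hc : 0 ≤ c)
    (hN : ∀ x, 0 ≤ N x) (h : ∀ l, N (fun i => A i l) ≤ c * N' (fun i => B i l)) :
    colNorm N A ≤ c * colNorm N' B := by
  rw [colNorm, colNorm, ← abs_of_nonneg hc, ← euclNorm_smul]
  refine euclNorm_mono (fun l => hN _) fun l => ?_
  simpa [abs_of_nonneg hc] using h l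

lemma colNorm_add_le (Ct : Matrix (Fin n) (Fin n) ℝ) (A B : RowMat n d) :
    colNorm (vecNorm Ct) (A + B) ≤ colNorm (vecNorm Ct) A + colNorm (vecNorm Ct) B := by
  refine le_trans (euclNorm_mono (fun l => vecNorm_nonneg _ _) fun l => ?_)
    (euclNorm_add_le _ _)
  exact vecNorm_add_le Ct (fun i => A i l) (fun i => B i l)

lemma colNorm_smul (Ct : Matrix (Fin n) (Fin n) ℝ) (c : ℝ) (A : RowMat n d) :
    colNorm (vecNorm Ct) (c • A) = |c| * colNorm (vecNorm Ct) A := by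
  rw [colNorm, colNorm, ← abs_abs c, ← euclNorm_smul]
  congr 1
  funext l
  exact vecNorm_smul Ct c (fun i => A i l)

lemma colNorm_sub_le (Ct : Matrix (Fin n) (Fin n) ℝ) (A B : RowMat n d) :
    colNorm (vecNorm Ct) (A - B) ≤ colNorm (vecNorm Ct) A + colNorm (vecNorm Ct) B := by
  have h := colNorm_add_le Ct A ((-1 : ℝ) • B)
  rwa [colNorm_smul, abs_neg, abs_one, one_mul, neg_one_smul, ← sub_eq_add_neg] at h

lemma colNorm_euclNorm_sq (A : RowMat n d) : colNorm euclNorm A ^ 2 = ∑ i, ‖A i‖ ^ 2 := by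
  simp only [colNorm, euclNorm_sq, EuclideanSpace.norm_sq_eq, Real.norm_eq_abs, sq_abs]
  exact Finset.sum_comm

lemma mix_col (W : Matrix (Fin n) (Fin n) ℝ) (A : RowMat n d) (l : Fin d) :
    (fun i => mix W A i l) = W *ᵥ fun i => A i l := by
  funext i
  simp [mix, mulVec, dotProduct]

lemma mix_add (W : Matrix (Fin n) (Fin n) ℝ) (A B : RowMat n d) :
    mix W (A + B) = mix W A + mix W B := by
  funext i; simp [mix, Finset.sum_add_distrib]

lemma mix_sub (W : Matrix (Fin n) (Fin n) ℝ) (A B : RowMat n d) :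
    mix W (A - B) = mix W A - mix W B := by
  funext i; simp [mix, smul_sub, Finset.sum_sub_distrib]

lemma mix_smul (W : Matrix (Fin n) (Fin n) ℝ) (c : ℝ) (A : RowMat n d) :
    mix W (c • A) = c • mix W A := by
  funext i; simp [mix, Finset.smul_sum, smul_comm c]

lemma mix_mix (W W' : Matrix (Fin n) (Fin n) ℝ) (A : RowMat n d) :
    mix W (mix W' A) = mix (W * W') A := by
  funext i
  simp only [mix, mul_apply, Finset.smul_sum, Finset.sum_smul, smul_smul]
  exact Finset.sum_comm

lemma mix_conMat_apply (p : Fin n → ℝ) (A : RowMat n d) (i : Fin n) :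
    mix (conMat p) A i = A i - p i • rowMean A := by
  have h : ∀ j, conMat p i j • A j = (if i = j then A j else 0) - (p i / n) • A j := fun j => by
    rw [conMat, Matrix.sub_apply, perronProj_apply, sub_smul, one_apply]
    split_ifs <;> simp
  simp only [mix, h, Finset.sum_sub_distrib, rowMean, smul_smul, ← Finset.smul_sum]
  simp [div_eq_mul_inv]

lemma rowMean_add (A B : RowMat n d) : rowMean (A + B) = rowMean A + rowMean B := by
  simp [rowMean, Finset.sum_add_distrib]

lemma rowMean_sub (A B : RowMat n d) : rowMean (A - B) = rowMean A - rowMean B := by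
  simp [rowMean, Finset.sum_sub_distrib, smul_sub]

lemma rowMean_smul (c : ℝ) (A : RowMat n d) : rowMean (c • A) = c • rowMean A := by
  simp [rowMean, ← Finset.smul_sum, smul_comm c]

lemma rowMean_mix {C : Matrix (Fin n) (Fin n) ℝ} (hC : C ∈ colStochastic ℝ (Fin n))
    (A : RowMat n d) : rowMean (mix C A) = rowMean A := by
  rw [rowMean, rowMean]
  congr 1
  simp only [mix]
  rw [Finset.sum_comm]
  simp [← Finset.sum_smul, sum_col_of_mem_colStochastic hC]

lemma norm_rowMean_sq_le (hn : 0 < n) (A : RowMat n d) :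
    ‖rowMean A‖ ^ 2 ≤ ∑ i, ‖A i‖ ^ 2 := by
  have h1 : ‖rowMean A‖ ≤ 1 / n * ∑ i, ‖A i‖ := by
    rw [rowMean, norm_smul, Real.norm_of_nonneg (by positivity)]
    gcongr
    exact norm_sum_le _ _
  have h2 := sq_sum_le_card_mul_sum_sq (s := Finset.univ) (f := fun i => ‖A i‖)
  rw [Finset.card_univ, Fintype.card_fin] at h2
  have hn' : (1 : ℝ) ≤ n := by exact_mod_cast hn
  have h0 : 0 ≤ ∑ i, ‖A i‖ ^ 2 := Finset.sum_nonneg fun _ _ => sq_nonneg _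
  calc ‖rowMean A‖ ^ 2 ≤ (1 / n * ∑ i, ‖A i‖) ^ 2 := pow_le_pow_left₀ (norm_nonneg _) h1 2
    _ = 1 / (n : ℝ) ^ 2 * (∑ i, ‖A i‖) ^ 2 := by ring
    _ ≤ 1 / (n : ℝ) ^ 2 * (n * ∑ i, ‖A i‖ ^ 2) := by gcongr
    _ = (1 / n) * ∑ i, ‖A i‖ ^ 2 := by field_simp
    _ ≤ 1 * ∑ i, ‖A i‖ ^ 2 := by
        gcongr
        rw [div_le_one (by linarith)]; exact hn'
    _ = _ := one_mul _

/-! ### Contraction and comparison estimates in an adapted norm -/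

section Adapted

variable {C Ct : Matrix (Fin n) (Fin n) ℝ} {p : Fin n → ℝ} {δ κ : ℝ}

lemma IsAdaptedNorm.gap_le_one (h : IsAdaptedNorm C p δ Ct κ) : δ ≤ 1 := by
  have : 0 ≤ inducedNorm Ct (C - perronProj p) :=
    Real.iSup_nonneg fun x => div_nonneg (vecNorm_nonneg _ _) (vecNorm_nonneg _ _)
  linarith [h.contract]

lemma IsAdaptedNorm.colNorm_le_eucl (h : IsAdaptedNorm C p δ Ct κ) (A : RowMat n d) :
    colNorm (vecNorm Ct) A ≤ colNorm euclNorm A := by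
  simpa using colNorm_le_mul (A := A) (B := A) zero_le_one (vecNorm_nonneg Ct)
    (fun l => by simpa using h.le_eucl _)

lemma IsAdaptedNorm.eucl_le_colNorm (h : IsAdaptedNorm C p δ Ct κ) (A : RowMat n d) :
    colNorm euclNorm A ≤ κ * colNorm (vecNorm Ct) A :=
  colNorm_le_mul (zero_le_one.trans h.one_le) euclNorm_nonneg fun _ => h.eucl_le _

lemma IsAdaptedNorm.colNorm_conMat_le (h : IsAdaptedNorm C p δ Ct κ) (A : RowMat n d) :
    colNorm (vecNorm Ct) (mix (conMat p) A) ≤ colNorm (vecNorm Ct) A := by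
  refine (colNorm_le_mul (A := mix (conMat p) A) (B := A) zero_le_one (vecNorm_nonneg Ct)
    fun l => ?_).trans_eq (one_mul _)
  rw [mix_col]
  exact h.mulVec_le h.proj _

/-- One mixing step contracts the consensus error. -/
lemma IsAdaptedNorm.colNorm_mix_le (hn : 0 < n) (hC : C ∈ colStochastic ℝ (Fin n))
    (hp : IsPerronVector C p) (h : IsAdaptedNorm C p δ Ct κ) (A : RowMat n d) :
    colNorm (vecNorm Ct) (mix (conMat p) (mix C A))
      ≤ (1 - δ) * colNorm (vecNorm Ct) (mix (conMat p) A) := by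
  rw [mix_mix, conMat_mul hn hC hp, ← mix_mix]
  refine colNorm_le_mul (by linarith [h.gap_le_one]) (vecNorm_nonneg Ct) fun l => ?_
  rw [mix_col]
  exact h.mulVec_le h.contract _

/-- The difference C^k v₀ - p has zero sum, so on it `C` acts as C - p1ᵀ/n. -/
lemma IsAdaptedNorm.vecNorm_iterate_sub_le (hC : C ∈ colStochastic ℝ (Fin n))
    (hp : IsPerronVector C p) (h : IsAdaptedNorm C p δ Ct κ) {v₀ : Fin n → ℝ}
    (hv : ∑ i, v₀ i = n) (k : ℕ) :
    vecNorm Ct ((C ^ k) *ᵥ v₀ - p) ≤ (1 - δ) ^ k * vecNorm Ct (v₀ - p) := by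
  induction k with
  | zero => simp
  | succ k ih =>
    have hs : ∑ i, ((C ^ k) *ᵥ v₀ - p) i = 0 := by
      simp [Finset.sum_sub_distrib, sum_mulVec_of_mem_colStochastic (pow_mem hC k), hv, hp.sum_eq]
    have h1 : (C ^ (k + 1)) *ᵥ v₀ - p = (C - perronProj p) *ᵥ ((C ^ k) *ᵥ v₀ - p) := by
      have h2 : perronProj p *ᵥ ((C ^ k) *ᵥ v₀ - p) = 0 := by
        funext i
        simp only [mulVec, dotProduct, perronProj_apply, ← Finset.mul_sum, Pi.zero_apply]
        exact mul_eq_zero_of_right _ hs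
      rw [sub_mulVec, h2, sub_zero, mulVec_sub, hp.eigen, mulVec_mulVec, ← pow_succ']
    rw [h1]
    calc _ ≤ (1 - δ) * vecNorm Ct ((C ^ k) *ᵥ v₀ - p) := h.mulVec_le h.contract _
      _ ≤ (1 - δ) * ((1 - δ) ^ k * vecNorm Ct (v₀ - p)) := by
          have := h.gap_le_one
          gcongr
      _ = _ := by ring

/-- Distance of the rescaled local variables from their average. -/
lemma IsAdaptedNorm.sum_invScale_sub_le (h : IsAdaptedNorm C p δ Ct κ) {v : Fin n → ℝ} {ν : ℝ}
    (hv : ∀ i, 0 < v i) (hν : ∀ i, (v i)⁻¹ ≤ ν) (A : RowMat n d) :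
    ∑ i, ‖invScale v A i - rowMean A‖ ^ 2
      ≤ 2 * ν ^ 2 * κ ^ 2 * (colNorm (vecNorm Ct) (mix (conMat p) A) ^ 2
        + (vecNorm Ct (v - p) * ‖rowMean A‖) ^ 2) := by
  set R : RowMat n d := fun i => (v i - p i) • rowMean A with hR
  -- A_i - v_i ā = (A_i - p_i ā) - (v_i - p_i) ā separates the consensus error from the imbalance of
  -- the weights.
  have h1 : ∀ i, invScale v A i - rowMean A = (v i)⁻¹ • (mix (conMat p) A - R) i := fun i => by
    rw [Pi.sub_apply, mix_conMat_apply, hR, invScale]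
    simp only [smul_sub, sub_smul, smul_smul, inv_mul_cancel₀ (hv i).ne', one_smul]
    abel
  have h2 : colNorm (vecNorm Ct) R ≤ vecNorm Ct (v - p) * ‖rowMean A‖ := by
    have hcol : ∀ l, vecNorm Ct (fun i => R i l)
        = (vecNorm Ct (v - p) • fun l => |rowMean A l|) l := fun l => by
      have : (fun i => R i l) = rowMean A l • (v - p) := by
        funext i; simp [hR]; ring
      rw [this, vecNorm_smul, Pi.smul_apply, smul_eq_mul, mul_comm]
    rw [colNorm, funext hcol, euclNorm_smul, abs_of_nonneg (vecNorm_nonneg _ _)]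
    refine le_of_eq ?_
    congr 1
    rw [euclNorm, EuclideanSpace.norm_eq, EuclideanSpace.norm_eq]
    simp
  have h3 : colNorm euclNorm (mix (conMat p) A - R) ≤ κ * (colNorm (vecNorm Ct)
      (mix (conMat p) A) + vecNorm Ct (v - p) * ‖rowMean A‖) := by
    refine (h.eucl_le_colNorm _).trans ?_
    have := zero_le_one.trans h.one_le
    gcongr
    exact (colNorm_sub_le _ _ _).trans (by gcongr)
  calc ∑ i, ‖invScale v A i - rowMean A‖ ^ 2
      ≤ ∑ i, ν ^ 2 * ‖(mix (conMat p) A - R) i‖ ^ 2 := by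
        refine Finset.sum_le_sum fun i _ => ?_
        have h0 := inv_pos.2 (hv i)
        rw [h1, norm_smul, mul_pow, Real.norm_of_nonneg h0.le]
        gcongr
        exact hν i
    _ = ν ^ 2 * colNorm euclNorm (mix (conMat p) A - R) ^ 2 := by
        rw [colNorm_euclNorm_sq, Finset.mul_sum]
    _ ≤ ν ^ 2 * (κ * (colNorm (vecNorm Ct) (mix (conMat p) A)
          + vecNorm Ct (v - p) * ‖rowMean A‖)) ^ 2 := by
        have := colNorm_nonneg euclNorm (mix (conMat p) A - R)
        gcongr
    _ = ν ^ 2 * κ ^ 2 * (colNorm (vecNorm Ct) (mix (conMat p) A)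
          + vecNorm Ct (v - p) * ‖rowMean A‖) ^ 2 := by ring
    _ ≤ ν ^ 2 * κ ^ 2 * (2 * (colNorm (vecNorm Ct) (mix (conMat p) A) ^ 2
          + (vecNorm Ct (v - p) * ‖rowMean A‖) ^ 2)) := by
        gcongr
        exact add_sq_le
    _ = _ := by ring

end Adapted

end RowMatrices


/-! ### Convex smooth functions -/

section Smooth

variable {n d : ℕ}

/-- The first-order lower bound, improved by the squared gradient difference. -/
lemma IsConvexSmooth.lower_bregman {L : ℝ} (hL : 0 < L) {f : EuclideanSpace ℝ (Fin d) → ℝ} (hf : IsConvexSmooth L f)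
    (x y : EuclideanSpace ℝ (Fin d)) :
    f x + ⟪∇ f x, y - x⟫ + 1 / (2 * L) * ‖∇ f y - ∇ f x‖ ^ 2 ≤ f y := by
  set g := ∇ f y - ∇ f x with hg
  -- The test point is y minus 1/L times the gradient difference: the lower bound from x and the
  -- upper bound from y are compared there.
  have h1 := hf.lower x (y - (1 / L) • g)
  have h2 := hf.upper y (y - (1 / L) • g)
  have e1 : y - (y - (1 / L) • g) = (1 / L) • g := by abel
  have e2 : y - (1 / L) • g - y = -((1 / L) • g) := by abel
  have e3 : y - (1 / L) • g - x = (y - x) - (1 / L) • g := by abel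
  rw [e3, inner_sub_right, inner_smul_right] at h1
  rw [e1, e2, inner_neg_right, inner_smul_right, norm_smul, mul_pow, Real.norm_eq_abs, sq_abs] at h2
  have h3 : ⟪∇ f y, g⟫ - ⟪∇ f x, g⟫ = ‖g‖ ^ 2 := by
    rw [← inner_sub_left, ← hg, real_inner_self_eq_norm_sq]
  have h4 : L / 2 * ((1 / L) ^ 2 * ‖g‖ ^ 2) = 1 / (2 * L) * ‖g‖ ^ 2 := by
    field_simp
  have h5 : 1 / L * ⟪∇ f y, g⟫ - 1 / L * ⟪∇ f x, g⟫ = 2 * (1 / (2 * L) * ‖g‖ ^ 2) := by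
    rw [← mul_sub, h3]; field_simp
  linarith

lemma IsConvexSmooth.norm_gradient_sub_sq_le {L : ℝ} (hL : 0 < L) {f : EuclideanSpace ℝ (Fin d) → ℝ}
    (hf : IsConvexSmooth L f) (x y : EuclideanSpace ℝ (Fin d)) :
    ‖∇ f y - ∇ f x‖ ^ 2 ≤ L ^ 2 * ‖y - x‖ ^ 2 := by
  have h1 := hf.lower_bregman hL x y
  have h2 := hf.upper x y
  rw [norm_sub_rev x y] at h2
  have h3 : 1 / (2 * L) * ‖∇ f y - ∇ f x‖ ^ 2 ≤ L / 2 * ‖y - x‖ ^ 2 := by linarith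
  have h4 : ‖∇ f y - ∇ f x‖ ^ 2 = 2 * L * (1 / (2 * L) * ‖∇ f y - ∇ f x‖ ^ 2) := by
    field_simp
  rw [h4]
  calc _ ≤ 2 * L * (L / 2 * ‖y - x‖ ^ 2) := by gcongr
    _ = _ := by ring

lemma avgObj_upper {L : ℝ} {f : Fin n → EuclideanSpace ℝ (Fin d) → ℝ} (hn : 0 < n) (hf : ∀ i, IsConvexSmooth L (f i))
    (x y : EuclideanSpace ℝ (Fin d)) :
    avgObj f y ≤ avgObj f x + ⟪rowMean (fun i => ∇ (f i) x), y - x⟫ + L / 2 * ‖x - y‖ ^ 2 := by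
  have hn' : (0 : ℝ) < n := by exact_mod_cast hn
  have h := Finset.sum_le_sum fun i (_ : i ∈ Finset.univ) => (hf i).upper x y
  simp only [Finset.sum_add_distrib, Finset.sum_const, Finset.card_univ, Fintype.card_fin,
    nsmul_eq_mul] at h
  rw [rowMean, real_inner_smul_left, sum_inner, avgObj, avgObj]
  calc _ ≤ 1 / (n : ℝ) * (∑ i, f i x + ∑ i, ⟪∇ (f i) x, y - x⟫ + n * (L / 2 * ‖x - y‖ ^ 2)) := by
        gcongr
    _ = _ := by field_simp

/-- Values of the objective near `y`, in terms of the gap at `y`. -/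
lemma avgObj_gap_le {L : ℝ} (hL : 0 < L) {f : Fin n → EuclideanSpace ℝ (Fin d) → ℝ} (hn : 0 < n)
    (hf : ∀ i, IsConvexSmooth L (f i)) {xs : EuclideanSpace ℝ (Fin d)} (hxs : ∀ x, avgObj f xs ≤ avgObj f x) (y w : EuclideanSpace ℝ (Fin d)) :
    avgObj f w - avgObj f xs ≤ 2 * (avgObj f y - avgObj f xs) + L * ‖w - y‖ ^ 2 := by
  set G := rowMean (fun i => ∇ (f i) y) with hG
  have h1 := avgObj_upper hn hf y w
  have h2 := avgObj_upper hn hf y (y - (1 / L) • G)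
  rw [← hG] at h1 h2
  have e1 : y - (y - (1 / L) • G) = (1 / L) • G := by abel
  have e2 : y - (1 / L) • G - y = -((1 / L) • G) := by abel
  rw [e1, e2, inner_neg_right, inner_smul_right, norm_smul, mul_pow, Real.norm_eq_abs, sq_abs,
    real_inner_self_eq_norm_sq] at h2
  -- Comparing the minimum with a gradient step from y gives ‖G‖²/(2L) ≤ f(y) - f(xs). Young's
  -- inequality then trades the linear term for this quantity, whence the factor 2.
  have h3 := hxs (y - (1 / L) • G)
  have h4 : L / 2 * ((1 / L) ^ 2 * ‖G‖ ^ 2) = 1 / (2 * L) * ‖G‖ ^ 2 := by field_simp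
  have h5 : 1 / L * ‖G‖ ^ 2 = 2 * (1 / (2 * L) * ‖G‖ ^ 2) := by field_simp
  have h6 : ⟪G, w - y⟫ ≤ 1 / (2 * L) * ‖G‖ ^ 2 + L / 2 * ‖w - y‖ ^ 2 := by
    have h7 := real_inner_le_norm G (w - y)
    have h8 : 0 ≤ 1 / (2 * L) * (‖G‖ - L * ‖w - y‖) ^ 2 := by positivity
    have h9 : 1 / (2 * L) * (‖G‖ - L * ‖w - y‖) ^ 2
        = 1 / (2 * L) * ‖G‖ ^ 2 + L / 2 * ‖w - y‖ ^ 2 - ‖G‖ * ‖w - y‖ := by field_simp; ring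
    linarith
  rw [norm_sub_rev y w] at h1
  linarith

/-- One step of the accelerated method with gradients evaluated at the perturbed points `w i`. -/
lemma accelerated_step {L : ℝ} (hL : 0 < L) {f : Fin n → EuclideanSpace ℝ (Fin d) → ℝ} (hn : 0 < n)
    (hf : ∀ i, IsConvexSmooth L (f i)) (xs y z : EuclideanSpace ℝ (Fin d)) (w : RowMat n d) {τ α θ η : ℝ}
    (hτ : 0 ≤ τ) (hτ1 : τ ≤ 1) (hατ : α * τ = θ) (hη : 0 < η) {x g : EuclideanSpace ℝ (Fin d)}
    (hx : x = (1 - τ) • y + τ • z) (hg : g = rowMean (gradF f w)) :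
    α ^ 2 * (avgObj f (x - η • g) - avgObj f xs) + θ / (2 * η) * ‖z - (α * η) • g - xs‖ ^ 2
      ≤ (1 - τ) * α ^ 2 * (avgObj f y - avgObj f xs) + θ / (2 * η) * ‖z - xs‖ ^ 2
        - α ^ 2 * (η * (1 - L * η - θ / 2) * ‖g‖ ^ 2)
        + α ^ 2 * (L / n * ∑ i, ‖w i - x‖ ^ 2)
        - α ^ 2 / (2 * L * n) * ((1 - τ) * ∑ i, ‖∇ (f i) y - ∇ (f i) (w i)‖ ^ 2
          + τ * ∑ i, ‖∇ (f i) xs - ∇ (f i) (w i)‖ ^ 2) := by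
  have hn' : (0 : ℝ) < n := by exact_mod_cast hn
  set y' := x - η • g with hy'
  -- All three expansions are made at `w i`: upper towards y', improved lower towards y (weight 1 -
  -- τ) and xs (weight τ). As y' = (1 - τ) y + τ z - η g, the linear terms merge into one inner
  -- product in which `w i` cancels.
  have hpt : ∀ i, f i y' ≤ (1 - τ) * f i y + τ * f i xs
      + ⟪∇ (f i) (w i), τ • (z - xs) - η • g⟫ + (L * ‖w i - x‖ ^ 2 + L * η ^ 2 * ‖g‖ ^ 2)
      - 1 / (2 * L) * ((1 - τ) * ‖∇ (f i) y - ∇ (f i) (w i)‖ ^ 2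
        + τ * ‖∇ (f i) xs - ∇ (f i) (w i)‖ ^ 2) := fun i => by
    have h1 := (hf i).upper (w i) y'
    have h2 := mul_le_mul_of_nonneg_left ((hf i).lower_bregman hL (w i) y) (sub_nonneg.2 hτ1)
    have h3 := mul_le_mul_of_nonneg_left ((hf i).lower_bregman hL (w i) xs) hτ
    have h4 : ‖w i - y'‖ ^ 2 ≤ 2 * ‖w i - x‖ ^ 2 + 2 * (η ^ 2 * ‖g‖ ^ 2) := by
      have e : w i - y' = (w i - x) + η • g := by rw [hy']; abel
      have h5 := norm_add_le (w i - x) (η • g)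
      rw [e]
      rw [norm_smul, Real.norm_of_nonneg hη.le] at h5
      nlinarith [sq_nonneg (‖w i - x‖ - η * ‖g‖), norm_nonneg (w i - x + η • g)]
    have h5 : τ • (z - xs) - η • g
        = (y' - w i) - (1 - τ) • (y - w i) - τ • (xs - w i) := by
      rw [hy', hx]; module
    have h6 : ⟪∇ (f i) (w i), τ • (z - xs) - η • g⟫ = ⟪∇ (f i) (w i), y' - w i⟫
        - (1 - τ) * ⟪∇ (f i) (w i), y - w i⟫ - τ * ⟪∇ (f i) (w i), xs - w i⟫ := by
      rw [h5, inner_sub_right, inner_sub_right, inner_smul_right, inner_smul_right]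
    have h7 := mul_le_mul_of_nonneg_left h4 (by positivity : 0 ≤ L / 2)
    linarith
  have hsum := Finset.sum_le_sum fun i (_ : i ∈ Finset.univ) => hpt i
  simp only [Finset.sum_add_distrib, Finset.sum_sub_distrib, Finset.sum_const, Finset.card_univ,
    Fintype.card_fin, nsmul_eq_mul, ← Finset.mul_sum, ← sum_inner] at hsum
  have hgs : ∑ i, ∇ (f i) (w i) = (n : ℝ) • g := by
    rw [hg, rowMean, smul_smul, mul_one_div_cancel hn'.ne', one_smul]; rfl
  rw [hgs, real_inner_smul_left] at hsum
  have hin : ⟪g, τ • (z - xs) - η • g⟫ = τ * ⟪g, z - xs⟫ - η * ‖g‖ ^ 2 := by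
    rw [inner_sub_right, inner_smul_right, inner_smul_right, real_inner_self_eq_norm_sq]
  rw [hin] at hsum
  have hz : ‖z - (α * η) • g - xs‖ ^ 2
      = ‖z - xs‖ ^ 2 - 2 * (α * η) * ⟪g, z - xs⟫ + (α * η) ^ 2 * ‖g‖ ^ 2 := by
    have e : z - (α * η) • g - xs = (z - xs) - (α * η) • g := by abel
    rw [e, norm_sub_sq_real, inner_smul_right, real_inner_comm, norm_smul, mul_pow,
      Real.norm_eq_abs, sq_abs]
    ring
  -- Because α τ = θ, the cross term is exactly α² τ ⟪g, z - xs⟫ and cancels the one from the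
  -- function values.
  have hz' : θ / (2 * η) * ‖z - (α * η) • g - xs‖ ^ 2
      = θ / (2 * η) * ‖z - xs‖ ^ 2 - α ^ 2 * (τ * ⟪g, z - xs⟫)
        + α ^ 2 * (θ * η / 2 * ‖g‖ ^ 2) := by
    rw [hz, ← hατ]; field_simp
  have hdiv := mul_le_mul_of_nonneg_left hsum (by positivity : 0 ≤ α ^ 2 * (1 / (n : ℝ)))
  rw [hz']
  simp only [avgObj]
  have e1 : α ^ 2 * (1 / (n : ℝ)) * ∑ i, f i y'
      = α ^ 2 * (1 / (n : ℝ) * ∑ i, f i y') := by ring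
  rw [e1] at hdiv
  refine le_of_sub_nonneg ((sub_nonneg.2 hdiv).trans_eq ?_)
  field_simp
  ring

end Smooth


/-! ### Momentum weights -/

section Weights

variable {β γ : ℝ}

lemma alpha_eq (θ β γ : ℝ) (k : ℕ) : alpha θ β γ k = alpha θ β γ 0 * (1 + β * k) := by
  simp only [alpha, tau, div_div_eq_mul_div]; push_cast; ring

lemma tau_pos (hγ : 0 < γ) (hβ : 0 < β) (k : ℕ) : 0 < tau β γ k := by
  unfold tau; positivity

lemma tau_succ_le (hγ : 0 < γ) (hβ : 0 < β) (k : ℕ) : tau β γ (k + 1) ≤ tau β γ k := by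
  unfold tau; gcongr; simp

lemma tau_le_one (hγ1 : γ ≤ 1) (hβ : 0 < β) (k : ℕ) : tau β γ k ≤ 1 := by
  unfold tau
  rw [div_le_one (by positivity)]
  nlinarith [mul_nonneg hβ.le (Nat.cast_nonneg (α := ℝ) k)]

lemma alpha_pos {θ : ℝ} (hθ : 0 < θ) (hγ : 0 < γ) (hβ : 0 < β) (k : ℕ) : 0 < alpha θ β γ k :=
  div_pos hθ (tau_pos hγ hβ k)

lemma alpha_mul_tau (θ : ℝ) (hγ : 0 < γ) (hβ : 0 < β) (k : ℕ) :
    alpha θ β γ k * tau β γ k = θ := div_mul_cancel₀ _ (tau_pos hγ hβ k).ne'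

lemma alpha_succ (θ β γ : ℝ) (k : ℕ) : alpha θ β γ (k + 1) = alpha θ β γ k + θ * β / γ := by
  simp only [alpha, tau, div_div_eq_mul_div]; push_cast; ring

lemma alpha_succ_le {θ : ℝ} (hθ : 0 < θ) (hγ : 0 < γ) (hβ : 0 < β) (hβ1 : β ≤ 1 / 4) (k : ℕ) :
    alpha θ β γ (k + 1) ≤ 5 / 4 * alpha θ β γ k := by
  have h0 := alpha_pos hθ hγ hβ 0
  rw [alpha_eq θ β γ (k + 1), alpha_eq θ β γ k]
  push_cast
  nlinarith [mul_nonneg h0.le (mul_nonneg hβ.le (Nat.cast_nonneg (α := ℝ) k))]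

lemma alpha_le_alpha_succ {θ : ℝ} (hθ : 0 < θ) (hγ : 0 < γ) (hβ : 0 < β) (k : ℕ) :
    alpha θ β γ k ≤ alpha θ β γ (k + 1) := by
  rw [alpha_succ]
  have : 0 < θ * β / γ := by positivity
  linarith

/-- By α τ = θ the left side is α_{k+1}² - θ α_{k+1}. The increment of α is θβ/γ ≤ θ/4, too small
for α² to grow by more than θ α_{k+1}. This is the condition for telescoping. -/
lemma one_sub_tau_mul_alpha_sq_le {θ : ℝ} (hθ : 0 < θ) (hγ : 0 < γ) (hβ : 0 < β)
    (hβγ : β ≤ γ / 4) (k : ℕ) :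
    (1 - tau β γ (k + 1)) * alpha θ β γ (k + 1) ^ 2 ≤ alpha θ β γ k ^ 2 := by
  have h1 : (1 - tau β γ (k + 1)) * alpha θ β γ (k + 1) ^ 2
      = alpha θ β γ (k + 1) ^ 2 - θ * alpha θ β γ (k + 1) := by
    linear_combination -alpha θ β γ (k + 1) * alpha_mul_tau θ hγ hβ (k + 1)
  have h2 : θ * β / γ ≤ θ / 4 := by
    rw [div_le_div_iff₀ hγ (by norm_num)]; nlinarith
  have h3 : 0 < θ * β / γ := by positivity
  have h4 := alpha_pos hθ hγ hβ k
  rw [h1, alpha_succ]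
  nlinarith

end Weights

/-! ### Lyapunov bounds -/

section Lyapunov

variable {δ β η : ℝ} {α : ℕ → ℝ}

/-- Weighted sums of the consensus errors: `x`, `z`, `g` stand for the consensus errors of `X`,
`τ Z`, `G`, and `b` for the change of the gradients. -/
lemma sum_consensus_le (hδ : 0 < δ) (hδ1 : δ ≤ 1) (hβ : 0 ≤ β) (hβ1 : β ≤ 1 / 4) (hη : 0 < η)
    (hα0 : 0 < α 0) (hα : ∀ k, α k = α 0 * (1 + β * k)) {x z g b : ℕ → ℝ}
    (hx : ∀ k, 0 ≤ x k) (hz : ∀ k, 0 ≤ z k) (hg : ∀ k, 0 ≤ g k)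
    (hxs : ∀ k, x (k + 1) ≤ (1 - δ) * (x k + η * g k) + z (k + 1))
    (hzs : ∀ k, z (k + 1) ≤ (1 - δ) * (z k + 1 / 4 * η * g k))
    (hgs : ∀ k, g (k + 1) ≤ (1 - δ) * g k + b k) (m : ℕ) :
    ∑ k ∈ Finset.range (m + 1), α k ^ 2 * (x k + 2 / δ * z k + 5 / 4 * η / δ ^ 2 * g k) ^ 2
      ≤ 3 / δ ^ 3 * (α 0 ^ 2 * (x 0 + 2 / δ * z 0 + 5 / 4 * η / δ ^ 2 * g 0) ^ 2)
        + 125 / 8 * η ^ 2 / δ ^ 8 * ∑ k ∈ Finset.range m, α k ^ 2 * b k ^ 2 := by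
  -- The errors form a hierarchy: g feeds x and z, and z feeds x. The weights 1, 2/δ and 5η/(4δ²)
  -- leave enough of each contraction to pay for the feeding at rate δ/2.
  have hrec : ∀ k, x (k + 1) + 2 / δ * z (k + 1) + 5 / 4 * η / δ ^ 2 * g (k + 1)
      ≤ (1 - δ / 2) * (x k + 2 / δ * z k + 5 / 4 * η / δ ^ 2 * g k)
        + 5 / 4 * η / δ ^ 2 * b k := fun k => by
    have h1 := mul_le_mul_of_nonneg_left (hzs k) (by positivity : 0 ≤ 1 + 2 / δ)
    have h2 := mul_le_mul_of_nonneg_left (hgs k) (by positivity : 0 ≤ 5 / 4 * η / δ ^ 2)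
    have e : (1 - δ / 2) * (x k + 2 / δ * z k + 5 / 4 * η / δ ^ 2 * g k)
          + 5 / 4 * η / δ ^ 2 * b k
        - ((1 - δ) * (x k + η * g k) + (1 + 2 / δ) * ((1 - δ) * (z k + 1 / 4 * η * g k))
          + 5 / 4 * η / δ ^ 2 * ((1 - δ) * g k + b k))
        = δ / 2 * x k + δ * z k
          + η * g k / δ * (5 / 8 - (1 - δ) * (δ + (δ + 2) / 4)) := by
      field_simp; ring
    -- The expression equals 5/4 ((δ - 3/10)² + 1/100).
    have h3 : 0 ≤ 5 / 8 - (1 - δ) * (δ + (δ + 2) / 4) := by nlinarith [sq_nonneg (δ - 3 / 10)]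
    have h4 : 0 ≤ δ / 2 * x k + δ * z k
          + η * g k / δ * (5 / 8 - (1 - δ) * (δ + (δ + 2) / 4)) := by
      have := hx k; have := hz k; have := hg k
      positivity
    linarith [hxs k]
  have hS := sum_weighted_sq_le_of_contract (half_pos hδ) (by linarith) hβ hβ1 hα0 hα
    (a := fun k => x k + 2 / δ * z k + 5 / 4 * η / δ ^ 2 * g k)
    (b := fun k => 5 / 4 * η / δ ^ 2 * b k)
    (fun k => by have := hx k; have := hz k; have := hg k; positivity) hrec m
  refine hS.trans_eq ?_
  simp only [mul_pow _ (b _), mul_left_comm (α _ ^ 2), ← Finset.mul_sum]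
  field_simp
  ring

/-- Weighted sums of the norms of the averages, damped by the convergence of the weights `v`:
`x`, `z`, `h` stand for the norms of `x̄`, `τ z̄` and of the average gradient. -/
lemma sum_average_le (hδ : 0 < δ) (hδ1 : δ ≤ 1) (hβ : 0 ≤ β) (hβ1 : β ≤ 1 / 4) (hη : 0 < η)
    (hα0 : 0 < α 0) (hα : ∀ k, α k = α 0 * (1 + β * k)) {x z h : ℕ → ℝ}
    (hx : ∀ k, 0 ≤ x k) (hz : ∀ k, 0 ≤ z k) (hh : ∀ k, 0 ≤ h k)
    (hxs : ∀ k, x (k + 1) ≤ (1 - δ) * (x k + η * h k) + z (k + 1))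
    (hzs : ∀ k, z (k + 1) ≤ (1 - δ) * (z k + 1 / 4 * η * h k)) (m : ℕ) :
    ∑ k ∈ Finset.range (m + 1), α k ^ 2 * (x k + 2 / δ * z k) ^ 2
      ≤ 3 / δ ^ 3 * (α 0 ^ 2 * (x 0 + 2 / δ * z 0) ^ 2)
        + 4 * η ^ 2 / δ ^ 6 * ∑ k ∈ Finset.range m, α k ^ 2 * h k ^ 2 := by
  have hrec : ∀ k, x (k + 1) + 2 / δ * z (k + 1)
      ≤ (1 - δ / 2) * (x k + 2 / δ * z k) + 5 / 8 * η / δ * h k := fun k => by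
    have h1 := mul_le_mul_of_nonneg_left (hzs k) (by positivity : 0 ≤ 1 + 2 / δ)
    have e : (1 - δ / 2) * (x k + 2 / δ * z k) + 5 / 8 * η / δ * h k
        - ((1 - δ) * (x k + η * h k) + (1 + 2 / δ) * ((1 - δ) * (z k + 1 / 4 * η * h k)))
        = δ / 2 * x k + δ * z k
          + η * h k / δ * (5 / 8 - (1 - δ) * (δ + (δ + 2) / 4)) := by
      field_simp; ring
    have h3 : 0 ≤ 5 / 8 - (1 - δ) * (δ + (δ + 2) / 4) := by nlinarith [sq_nonneg (δ - 3 / 10)]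
    have h4 : 0 ≤ δ / 2 * x k + δ * z k
          + η * h k / δ * (5 / 8 - (1 - δ) * (δ + (δ + 2) / 4)) := by
      have := hx k; have := hz k; have := hh k
      positivity
    linarith [hxs k]
  have hS := sum_weighted_sq_le_of_contract (half_pos hδ) (by linarith) hβ hβ1 hα0 hα
    (a := fun k => x k + 2 / δ * z k) (b := fun k => 5 / 8 * η / δ * h k)
    (fun k => by have := hx k; have := hz k; positivity) hrec m
  refine hS.trans ?_
  simp only [mul_pow _ (h _), mul_left_comm (α _ ^ 2), ← Finset.mul_sum]
  set H := ∑ k ∈ Finset.range m, α k ^ 2 * h k ^ 2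
  have hH : 0 ≤ H := Finset.sum_nonneg fun k _ => by positivity
  have e1 : 5 / (8 * (δ / 2) ^ 4) * ((5 / 8 * η / δ) ^ 2 * H)
      = (125 / 32) * (η ^ 2 / δ ^ 6 * H) := by field_simp; ring
  have e2 : 3 / (8 * (δ / 2) ^ 3) = 3 / δ ^ 3 := by field_simp; norm_num
  have h5 : 0 ≤ η ^ 2 / δ ^ 6 * H := by positivity
  rw [e1, e2, show 4 * η ^ 2 / δ ^ 6 * H = 4 * (η ^ 2 / δ ^ 6 * H) by ring]
  linarith

/-- Summation of the step inequalities. -/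
lemma telescope_le {α τ F D e : ℕ → ℝ} {c : ℝ} (hF : ∀ k, 0 ≤ F k)
    (hα : ∀ k, (1 - τ (k + 1)) * α (k + 1) ^ 2 ≤ α k ^ 2)
    (h : ∀ k, α k ^ 2 * F (k + 1) + c * D (k + 1)
      ≤ (1 - τ k) * α k ^ 2 * F k + c * D k + e k) (m : ℕ) :
    α m ^ 2 * F (m + 1) + c * D (m + 1)
      ≤ (1 - τ 0) * α 0 ^ 2 * F 0 + c * D 0 + ∑ k ∈ Finset.range (m + 1), e k := by
  induction m with
  | zero => simpa using h 0
  | succ m ih =>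
    rw [Finset.sum_range_succ]
    have := mul_le_mul_of_nonneg_right (hα m) (hF (m + 1))
    linarith [h (m + 1)]

/-- Absorption of the consensus errors into the descent terms. Here `SE`, `SS`, `ST`, `SG`, `SB`,
`Sb` are weighted sums, `I` collects the initial errors and `A` the optimization errors. -/
lemma absorb_errors {L n ν κ a δ η SE SS ST SG SB Sb s₀ t₀ A P Eo G : ℝ} (hL : 0 < L)
    (hn : 0 < n) (hδ : 0 < δ) (hη : 0 < η) (hSE : 0 ≤ SE) (hSG : 0 ≤ SG) (hSB : 0 ≤ SB)
    (hs₀ : 0 ≤ s₀) (ht₀ : 0 ≤ t₀)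
    (h₁ : SE ≤ 2 * ν ^ 2 * κ ^ 2 * (SS + a ^ 2 * ST))
    (h₂ : SS ≤ 3 / δ ^ 3 * s₀ + 125 / 8 * η ^ 2 / δ ^ 8 * Sb)
    (h₃ : ST ≤ 3 / δ ^ 3 * t₀ + 4 * η ^ 2 / δ ^ 6 * SG)
    (h₄ : Sb ≤ 9 / 2 * SB + 25 / 4 * L ^ 2 * (n * η ^ 2 * SG + SE))
    (h₅ : P ≤ A - η * (1 - L * η - 1 / 8) * SG + L / n * SE - 1 / (2 * L * n) * SB)
    (h₆ : Eo ≤ 2 * ν ^ 2 * κ ^ 2 * (SS + a ^ 2 * (2 * ST + 2 * η ^ 2 * SG)))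
    (hG : G ≤ 2 * P + L / n * Eo)
    (hs1 : ν ^ 2 * κ ^ 2 * η ^ 2 * L ^ 2 ≤ 1 / 100000 * δ ^ 8)
    (hs2 : a ^ 2 * ν ^ 2 * κ ^ 2 * η * L ≤ 1 / 100000 * (n * δ ^ 6))
    (hs2' : δ ≤ 1)
    (hs3 : η * L ≤ 1 / 2) :
    G ≤ 2 * A + 30 * (L / n) * ν ^ 2 * κ ^ 2 / δ ^ 3 * (s₀ + a ^ 2 * t₀) := by
  set U := L / n * SE with hU
  set V := 1 / (L * n) * SB with hV
  set W := η * SG with hW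
  set I := L / n * (2 * ν ^ 2 * κ ^ 2) * (3 / δ ^ 3) * (s₀ + a ^ 2 * t₀) with hI
  have hU0 : 0 ≤ U := by positivity
  have hV0 : 0 ≤ V := by positivity
  have hW0 : 0 ≤ W := by positivity
  have hI0 : 0 ≤ I := by positivity
  have hSb : 1 / (L * n) * Sb ≤ 9 / 2 * V + 25 / 4 * (1 / 2 * W + U) := by
    calc 1 / (L * n) * Sb
        ≤ 1 / (L * n) * (9 / 2 * SB + 25 / 4 * L ^ 2 * (n * η ^ 2 * SG + SE)) := by gcongr
      _ = 9 / 2 * V + 25 / 4 * (η * L * W + U) := by rw [hV, hU, hW]; field_simp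
      _ ≤ _ := by gcongr
  -- The gain of the loop from gradient changes to consensus errors and back; the step-size bound
  -- `hs1` makes it tiny.
  have hc1 : L / n * (2 * ν ^ 2 * κ ^ 2) * (125 / 8 * η ^ 2 / δ ^ 8)
      ≤ 1 / 3000 * (1 / (L * n)) := by
    have e : L / n * (2 * ν ^ 2 * κ ^ 2) * (125 / 8 * η ^ 2 / δ ^ 8)
        = 125 / 4 * (ν ^ 2 * κ ^ 2 * η ^ 2 * L ^ 2 / δ ^ 8) * (1 / (L * n)) := by field_simp; ring
    rw [e]
    have : ν ^ 2 * κ ^ 2 * η ^ 2 * L ^ 2 / δ ^ 8 ≤ 1 / 100000 := by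
      rwa [div_le_iff₀ (by positivity)]
    gcongr
    linarith
  have hc2 : L / n * (2 * ν ^ 2 * κ ^ 2) * a ^ 2 * (η ^ 2 / δ ^ 6) ≤ 1 / 50000 * η := by
    have e : L / n * (2 * ν ^ 2 * κ ^ 2) * a ^ 2 * (η ^ 2 / δ ^ 6)
        = 2 * (a ^ 2 * ν ^ 2 * κ ^ 2 * η * L / (n * δ ^ 6)) * η := by field_simp
    rw [e]
    have : a ^ 2 * ν ^ 2 * κ ^ 2 * η * L / (n * δ ^ 6) ≤ 1 / 100000 := by
      rwa [div_le_iff₀ (by positivity)]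
    gcongr
    linarith
  have hc2' : L / n * (2 * ν ^ 2 * κ ^ 2) * a ^ 2 * (η ^ 2 / δ ^ 6) * SG ≤ 1 / 50000 * W := by
    rw [hW]; exact (mul_le_mul_of_nonneg_right hc2 hSG).trans_eq (by ring)
  have hc3 : L / n * (2 * ν ^ 2 * κ ^ 2) * a ^ 2 * η ^ 2 * SG ≤ 1 / 50000 * W := by
    refine le_trans ?_ hc2'
    gcongr
    rw [le_div_iff₀ (by positivity)]
    exact mul_le_of_le_one_right (by positivity) (pow_le_one₀ hδ.le hs2')
  have hc1' : L / n * (2 * ν ^ 2 * κ ^ 2) * (125 / 8 * η ^ 2 / δ ^ 8) * Sb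
      ≤ 1 / 3000 * (9 / 2 * V + 25 / 4 * (1 / 2 * W + U)) := by
    -- Enlarging the coefficient of `Sb` needs its sign; for negative `Sb` the left side is at most
    -- 0.
    by_cases hb : 0 ≤ Sb
    · calc _ ≤ 1 / 3000 * (1 / (L * n)) * Sb := by gcongr
        _ = 1 / 3000 * (1 / (L * n) * Sb) := by ring
        _ ≤ _ := by gcongr
    · push Not at hb
      have h1 : L / n * (2 * ν ^ 2 * κ ^ 2) * (125 / 8 * η ^ 2 / δ ^ 8) * Sb ≤ 0 :=
        mul_nonpos_of_nonneg_of_nonpos (by positivity) hb.le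
      have h2 : 0 ≤ 1 / 3000 * (9 / 2 * V + 25 / 4 * (1 / 2 * W + U)) := by positivity
      linarith
  set c := L / n * (2 * ν ^ 2 * κ ^ 2) with hc
  have hc0 : 0 ≤ c := by positivity
  have hk2 := mul_le_mul_of_nonneg_left h₂ hc0
  have hk3 := mul_le_mul_of_nonneg_left h₃ (by positivity : 0 ≤ c * a ^ 2)
  have hUle : U ≤ c * SS + c * a ^ 2 * ST := by
    have := mul_le_mul_of_nonneg_left h₁ (by positivity : 0 ≤ L / n)
    rw [hU]; refine this.trans_eq ?_; rw [hc]; ring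
  have hEo : L / n * Eo ≤ c * SS + 2 * (c * a ^ 2 * ST) + 2 * (c * a ^ 2 * η ^ 2 * SG) := by
    have := mul_le_mul_of_nonneg_left h₆ (by positivity : 0 ≤ L / n)
    refine this.trans_eq ?_; rw [hc]; ring
  have e3 : c * a ^ 2 * (3 / δ ^ 3 * t₀ + 4 * η ^ 2 / δ ^ 6 * SG)
      = c * (3 / δ ^ 3) * (a ^ 2 * t₀) + 4 * (c * a ^ 2 * (η ^ 2 / δ ^ 6) * SG) := by ring
  have e2 : c * (3 / δ ^ 3 * s₀ + 125 / 8 * η ^ 2 / δ ^ 8 * Sb)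
      = c * (3 / δ ^ 3) * s₀ + c * (125 / 8 * η ^ 2 / δ ^ 8) * Sb := by ring
  rw [e3] at hk3
  rw [e2] at hk2
  have eI : I = c * (3 / δ ^ 3) * s₀ + c * (3 / δ ^ 3) * (a ^ 2 * t₀) := by rw [hI]; ring
  have hs0' : 0 ≤ c * (3 / δ ^ 3) * s₀ := by positivity
  have eV : 1 / (2 * L * n) * SB = 1 / 2 * V := by rw [hV]; field_simp
  have eW : η * (1 - L * η - 1 / 8) * SG = (1 - η * L - 1 / 8) * W := by rw [hW]; ring
  have hW2 : 3 / 8 * W ≤ (1 - η * L - 1 / 8) * W := by gcongr; linarith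
  rw [eV, eW] at h₅
  -- Up to small multiples of U, V, W, the term 2U contributes 2I and the output error at most 2I.
  -- The fifth I and the negative terms in W and V pay for the small multiples.
  have hfin : G ≤ 2 * A + 5 * I := by linarith
  refine hfin.trans_eq ?_
  rw [hI, hc]; ring

end Lyapunov


open Matrix

/-! ### The iterates -/

section Iterates

variable {n d : ℕ}

/-- The points `V⁻¹ X` at which the gradients are evaluated. -/
noncomputable def AlgState.W (s : AlgState n d) : RowMat n d := invScale s.v s.X

variable (f : Fin n → EuclideanSpace ℝ (Fin d) → ℝ) (C : Matrix (Fin n) (Fin n) ℝ) (θ β γ η : ℝ) (X₀ : RowMat n d)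
  (v₀ : Fin n → ℝ)

lemma iter_v (k : ℕ) : (iter f C θ β γ η X₀ v₀ k).v = (C ^ k) *ᵥ v₀ := by
  induction k with
  | zero => simp [iter, initState]
  | succ k ih => rw [iter, step]; simp only; rw [ih, mulVec_mulVec, pow_succ']

lemma iter_X (k : ℕ) : (iter f C θ β γ η X₀ v₀ k).X
    = (1 - tau β γ k) • (iter f C θ β γ η X₀ v₀ k).Y
      + tau β γ k • (iter f C θ β γ η X₀ v₀ k).Z := by
  cases k with
  | zero => simp only [iter, initState, ← add_smul, sub_add_cancel, one_smul]
  | succ k => rfl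

variable {C}

/-- The invariant of gradient tracking: it holds at the start, mixing keeps averages, and the
gradient correction telescopes. -/
lemma rowMean_iter_G (hC : C ∈ colStochastic ℝ (Fin n)) (k : ℕ) :
    rowMean (iter f C θ β γ η X₀ v₀ k).G
      = rowMean (gradF f (iter f C θ β γ η X₀ v₀ k).W) := by
  induction k with
  | zero => rfl
  | succ k ih =>
    have h : (iter f C θ β γ η X₀ v₀ (k + 1)).G = mix C (iter f C θ β γ η X₀ v₀ k).G
        + gradF f (iter f C θ β γ η X₀ v₀ (k + 1)).W
        - gradF f (iter f C θ β γ η X₀ v₀ k).W := rfl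
    rw [h, rowMean_sub, rowMean_add, rowMean_mix hC, ih]
    abel

lemma rowMean_iter_Y (hC : C ∈ colStochastic ℝ (Fin n)) (k : ℕ) :
    rowMean (iter f C θ β γ η X₀ v₀ (k + 1)).Y = rowMean (iter f C θ β γ η X₀ v₀ k).X
      - η • rowMean (iter f C θ β γ η X₀ v₀ k).G := by
  rw [← rowMean_smul, ← rowMean_sub]; exact rowMean_mix hC _

lemma rowMean_iter_Z (hC : C ∈ colStochastic ℝ (Fin n)) (k : ℕ) :
    rowMean (iter f C θ β γ η X₀ v₀ (k + 1)).Z = rowMean (iter f C θ β γ η X₀ v₀ k).Z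
      - (alpha θ β γ k * η) • rowMean (iter f C θ β γ η X₀ v₀ k).G := by
  rw [← rowMean_smul, ← rowMean_sub]; exact rowMean_mix hC _

lemma rowMean_iter_X (k : ℕ) :
    rowMean (iter f C θ β γ η X₀ v₀ k).X = (1 - tau β γ k) • rowMean (iter f C θ β γ η X₀ v₀ k).Y
      + tau β γ k • rowMean (iter f C θ β γ η X₀ v₀ k).Z := by
  conv_lhs => rw [iter_X]
  rw [rowMean_add, rowMean_smul, rowMean_smul]

/-! ### Recursions for consensus errors and for norms of the averages -/

section Consensus

variable {Ct : Matrix (Fin n) (Fin n) ℝ} {p : Fin n → ℝ} {δ κ : ℝ} {η}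

lemma IsAdaptedNorm.colNorm_mix_sub_le (hn : 0 < n) (hC : C ∈ colStochastic ℝ (Fin n))
    (hp : IsPerronVector C p) (h : IsAdaptedNorm C p δ Ct κ) (A B : RowMat n d) {c : ℝ}
    (hc : 0 ≤ c) :
    colNorm (vecNorm Ct) (mix (conMat p) (mix C (A - c • B)))
      ≤ (1 - δ) * (colNorm (vecNorm Ct) (mix (conMat p) A)
        + c * colNorm (vecNorm Ct) (mix (conMat p) B)) := by
  refine (h.colNorm_mix_le hn hC hp _).trans ?_
  have h1 := colNorm_sub_le Ct (mix (conMat p) A) (c • mix (conMat p) B)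
  rw [colNorm_smul, abs_of_nonneg hc, ← mix_smul, ← mix_sub] at h1
  have := h.gap_le_one
  gcongr

lemma consensus_Y_le (hn : 0 < n) (hC : C ∈ colStochastic ℝ (Fin n)) (hp : IsPerronVector C p)
    (h : IsAdaptedNorm C p δ Ct κ) (hη : 0 ≤ η) (k : ℕ) :
    colNorm (vecNorm Ct) (mix (conMat p) (iter f C θ β γ η X₀ v₀ (k + 1)).Y)
      ≤ (1 - δ) * (colNorm (vecNorm Ct) (mix (conMat p) (iter f C θ β γ η X₀ v₀ k).X)
        + η * colNorm (vecNorm Ct) (mix (conMat p) (iter f C θ β γ η X₀ v₀ k).G)) :=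
  h.colNorm_mix_sub_le hn hC hp _ _ hη

variable {θ β γ}

/-- Z moves with the growing step α_k η. Multiplying by τ, which decreases and satisfies α_k τ_k =
θ, gives a recursion with constant coefficients. -/
lemma consensus_Z_le (hn : 0 < n) (hC : C ∈ colStochastic ℝ (Fin n)) (hp : IsPerronVector C p)
    (h : IsAdaptedNorm C p δ Ct κ) (hη : 0 ≤ η) (hθ : 0 < θ) (hγ : 0 < γ) (hβ : 0 < β) (k : ℕ) :
    tau β γ (k + 1) * colNorm (vecNorm Ct) (mix (conMat p) (iter f C θ β γ η X₀ v₀ (k + 1)).Z)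
      ≤ (1 - δ) *
        (tau β γ k * colNorm (vecNorm Ct) (mix (conMat p) (iter f C θ β γ η X₀ v₀ k).Z)
          + θ * η * colNorm (vecNorm Ct) (mix (conMat p) (iter f C θ β γ η X₀ v₀ k).G)) := by
  have h1 : colNorm (vecNorm Ct) (mix (conMat p) (iter f C θ β γ η X₀ v₀ (k + 1)).Z) ≤ _ :=
    h.colNorm_mix_sub_le hn hC hp _ _ (mul_nonneg (alpha_pos hθ hγ hβ k).le hη)
  calc _ ≤ tau β γ k *
        colNorm (vecNorm Ct) (mix (conMat p) (iter f C θ β γ η X₀ v₀ (k + 1)).Z) :=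
        mul_le_mul_of_nonneg_right (tau_succ_le hγ hβ k) (colNorm_nonneg _ _)
    _ ≤ _ := mul_le_mul_of_nonneg_left h1 (tau_pos hγ hβ k).le
    _ = _ := by
        have h2 := alpha_mul_tau θ hγ hβ k
        linear_combination (1 - δ) * η * colNorm (vecNorm Ct)
          (mix (conMat p) (iter f C θ β γ η X₀ v₀ k).G) * h2

lemma consensus_X_le (hγ : 0 < γ) (hγ1 : γ ≤ 1) (hβ : 0 < β) (k : ℕ) :
    colNorm (vecNorm Ct) (mix (conMat p) (iter f C θ β γ η X₀ v₀ k).X)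
      ≤ colNorm (vecNorm Ct) (mix (conMat p) (iter f C θ β γ η X₀ v₀ k).Y)
        + tau β γ k * colNorm (vecNorm Ct) (mix (conMat p) (iter f C θ β γ η X₀ v₀ k).Z) := by
  have h0 := tau_pos hγ hβ k
  have h1 := tau_le_one hγ1 hβ k
  rw [iter_X, mix_add, mix_smul, mix_smul]
  refine (colNorm_add_le _ _ _).trans ?_
  rw [colNorm_smul, colNorm_smul, abs_of_pos h0, abs_of_nonneg (sub_nonneg.2 h1)]
  gcongr
  exact mul_le_of_le_one_left (colNorm_nonneg _ _) (by linarith)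

lemma consensus_G_le (hn : 0 < n) (hC : C ∈ colStochastic ℝ (Fin n)) (hp : IsPerronVector C p)
    (h : IsAdaptedNorm C p δ Ct κ) (k : ℕ) :
    colNorm (vecNorm Ct) (mix (conMat p) (iter f C θ β γ η X₀ v₀ (k + 1)).G)
      ≤ (1 - δ) * colNorm (vecNorm Ct) (mix (conMat p) (iter f C θ β γ η X₀ v₀ k).G)
        + colNorm euclNorm (gradF f (iter f C θ β γ η X₀ v₀ (k + 1)).W
          - gradF f (iter f C θ β γ η X₀ v₀ k).W) := by
  have e : (iter f C θ β γ η X₀ v₀ (k + 1)).G = mix C (iter f C θ β γ η X₀ v₀ k).G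
      + (gradF f (iter f C θ β γ η X₀ v₀ (k + 1)).W
        - gradF f (iter f C θ β γ η X₀ v₀ k).W) := by
    rw [← add_sub_assoc]; rfl
  rw [e, mix_add]
  refine (colNorm_add_le _ _ _).trans (add_le_add (h.colNorm_mix_le hn hC hp _) ?_)
  exact (h.colNorm_conMat_le _).trans (h.colNorm_le_eucl _)

lemma average_Z_le (hC : C ∈ colStochastic ℝ (Fin n)) (hη : 0 ≤ η) (hθ : 0 < θ)
    (hγ : 0 < γ) (hβ : 0 < β) (k : ℕ) :
    tau β γ (k + 1) * ‖rowMean (iter f C θ β γ η X₀ v₀ (k + 1)).Z‖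
      ≤ tau β γ k * ‖rowMean (iter f C θ β γ η X₀ v₀ k).Z‖
          + θ * η * ‖rowMean (iter f C θ β γ η X₀ v₀ k).G‖ := by
  have h1 : ‖rowMean (iter f C θ β γ η X₀ v₀ (k + 1)).Z‖
      ≤ ‖rowMean (iter f C θ β γ η X₀ v₀ k).Z‖
        + alpha θ β γ k * η * ‖rowMean (iter f C θ β γ η X₀ v₀ k).G‖ := by
    rw [rowMean_iter_Z f θ β γ η X₀ v₀ hC]
    refine (norm_sub_le _ _).trans_eq ?_
    rw [norm_smul, Real.norm_of_nonneg (mul_nonneg (alpha_pos hθ hγ hβ k).le hη)]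
  calc _ ≤ tau β γ k * ‖rowMean (iter f C θ β γ η X₀ v₀ (k + 1)).Z‖ :=
        mul_le_mul_of_nonneg_right (tau_succ_le hγ hβ k) (norm_nonneg _)
    _ ≤ _ := mul_le_mul_of_nonneg_left h1 (tau_pos hγ hβ k).le
    _ = _ := by
        have h2 := alpha_mul_tau θ hγ hβ k
        linear_combination η * ‖rowMean (iter f C θ β γ η X₀ v₀ k).G‖ * h2

lemma average_Y_le (hC : C ∈ colStochastic ℝ (Fin n)) (hη : 0 ≤ η) (k : ℕ) :
    ‖rowMean (iter f C θ β γ η X₀ v₀ (k + 1)).Y‖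
      ≤ ‖rowMean (iter f C θ β γ η X₀ v₀ k).X‖
          + η * ‖rowMean (iter f C θ β γ η X₀ v₀ k).G‖ := by
  rw [rowMean_iter_Y f θ β γ η X₀ v₀ hC]
  refine (norm_sub_le _ _).trans_eq ?_
  rw [norm_smul, Real.norm_of_nonneg hη]

lemma average_X_le (hγ : 0 < γ) (hγ1 : γ ≤ 1) (hβ : 0 < β) (k : ℕ) :
    ‖rowMean (iter f C θ β γ η X₀ v₀ k).X‖
      ≤ ‖rowMean (iter f C θ β γ η X₀ v₀ k).Y‖
        + tau β γ k * ‖rowMean (iter f C θ β γ η X₀ v₀ k).Z‖ := by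
  have h0 := tau_pos hγ hβ k
  have h1 := tau_le_one hγ1 hβ k
  rw [rowMean_iter_X]
  refine (norm_add_le _ _).trans ?_
  rw [norm_smul, norm_smul, Real.norm_of_nonneg h0.le, Real.norm_of_nonneg (sub_nonneg.2 h1)]
  gcongr
  exact mul_le_of_le_one_left (norm_nonneg _) (by linarith)

end Consensus

lemma norm_sub_sq_le_two_mul {E : Type*} [NormedAddCommGroup E] (a b c : E) :
    ‖a - b‖ ^ 2 ≤ 2 * ‖c - a‖ ^ 2 + 2 * ‖c - b‖ ^ 2 := by
  have h : ‖a - b‖ ≤ ‖c - a‖ + ‖c - b‖ := by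
    rw [show a - b = (c - b) - (c - a) by abel, add_comm]
    exact norm_sub_le _ _
  nlinarith [sq_nonneg (‖c - a‖ - ‖c - b‖), norm_nonneg (a - b)]

variable {f} {θ β γ η}

/-- The change of the gradients in one step. The intermediate points are the average of `Y` with
weight `1 - τ`, and an arbitrary point `xs` with weight `τ`. -/
lemma weighted_gradient_change_le {L : ℝ} (hL : 0 < L) (hf : ∀ i, IsConvexSmooth L (f i))
    (hC : C ∈ colStochastic ℝ (Fin n)) (hθ : 0 < θ) (hγ : 0 < γ) (hγ1 : γ ≤ 1) (hβ : 0 < β)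
    (hβ1 : β ≤ 1 / 4) (xs : EuclideanSpace ℝ (Fin d)) (k : ℕ) :
    alpha θ β γ k ^ 2 * colNorm euclNorm (gradF f (iter f C θ β γ η X₀ v₀ (k + 1)).W
          - gradF f (iter f C θ β γ η X₀ v₀ k).W) ^ 2
      ≤ 2 * (alpha θ β γ (k + 1) ^ 2 * ((1 - tau β γ (k + 1)) *
            ∑ i, ‖∇ (f i) (rowMean (iter f C θ β γ η X₀ v₀ (k + 1)).Y)
              - ∇ (f i) ((iter f C θ β γ η X₀ v₀ (k + 1)).W i)‖ ^ 2
          + tau β γ (k + 1) *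
            ∑ i, ‖∇ (f i) xs - ∇ (f i) ((iter f C θ β γ η X₀ v₀ (k + 1)).W i)‖ ^ 2))
        + 5 / 2 * (alpha θ β γ k ^ 2 * (tau β γ k *
            ∑ i, ‖∇ (f i) xs - ∇ (f i) ((iter f C θ β γ η X₀ v₀ k).W i)‖ ^ 2))
        + 25 / 4 * L ^ 2 * (n * η ^ 2 *
            (alpha θ β γ k ^ 2 * ‖rowMean (iter f C θ β γ η X₀ v₀ k).G‖ ^ 2)
          + alpha θ β γ k ^ 2 * ∑ i, ‖(iter f C θ β γ η X₀ v₀ k).W i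
            - rowMean (iter f C θ β γ η X₀ v₀ k).X‖ ^ 2) := by
  set s := iter f C θ β γ η X₀ v₀ k with hs
  set s' := iter f C θ β γ η X₀ v₀ (k + 1) with hs'
  set τ := tau β γ (k + 1) with hτ
  set a := alpha θ β γ k
  set a' := alpha θ β γ (k + 1)
  have hτ0 : 0 < τ := tau_pos hγ hβ _
  have hτ1 : τ ≤ 1 := tau_le_one hγ1 hβ _
  have ha : 0 < a := alpha_pos hθ hγ hβ k
  have haa : a ≤ a' := alpha_le_alpha_succ hθ hγ hβ k
  have haa' : a' ≤ 5 / 4 * a := alpha_succ_le hθ hγ hβ hβ1 k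
  have haτ : a * tau β γ k = θ := alpha_mul_tau θ hγ hβ k
  have haτ' : a' * τ = θ := alpha_mul_tau θ hγ hβ (k + 1)
  set By := ∑ i, ‖∇ (f i) (rowMean s'.Y) - ∇ (f i) (s'.W i)‖ ^ 2
  set Bs' := ∑ i, ‖∇ (f i) xs - ∇ (f i) (s'.W i)‖ ^ 2
  set Bs := ∑ i, ‖∇ (f i) xs - ∇ (f i) (s.W i)‖ ^ 2
  set Bc := ∑ i, ‖∇ (f i) (rowMean s'.Y) - ∇ (f i) (s.W i)‖ ^ 2
  set E := ∑ i, ‖s.W i - rowMean s.X‖ ^ 2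
  have hBs0 : 0 ≤ Bs := Finset.sum_nonneg fun _ _ => sq_nonneg _
  have hE0 : 0 ≤ E := Finset.sum_nonneg fun _ _ => sq_nonneg _
  have hBc0 : 0 ≤ Bc := Finset.sum_nonneg fun _ _ => sq_nonneg _
  set b := colNorm euclNorm (gradF f s'.W - gradF f s.W) ^ 2 with hb
  have hbsum : b = ∑ i, ‖∇ (f i) (s'.W i) - ∇ (f i) (s.W i)‖ ^ 2 := colNorm_euclNorm_sq _
  -- Two detours between the old and the new gradients, through the new ȳ (`h1`) and through `xs`
  -- (`h2`). Mixed with weights 1 - τ and τ in `h5`, they leave gradient differences that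
  -- `accelerated_step` subtracts at step k or k + 1, and `Bc`.
  have h1 : b ≤ 2 * By + 2 * Bc := by
    rw [hbsum, Finset.mul_sum, Finset.mul_sum, ← Finset.sum_add_distrib]
    exact Finset.sum_le_sum fun i _ => norm_sub_sq_le_two_mul _ _ _
  have h2 : b ≤ 2 * Bs' + 2 * Bs := by
    rw [hbsum, Finset.mul_sum, Finset.mul_sum, ← Finset.sum_add_distrib]
    exact Finset.sum_le_sum fun i _ => norm_sub_sq_le_two_mul _ _ _
  -- ȳ_{k+1} = x̄_k - η ḡ_k, so its distance to the old evaluation points is bounded by η‖ḡ_k‖ and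
  -- the old error.
  have h3 : Bc ≤ L ^ 2 * (2 * (n * η ^ 2 * ‖rowMean s.G‖ ^ 2) + 2 * E) := by
    have h4 : ∀ i, ‖∇ (f i) (rowMean s'.Y) - ∇ (f i) (s.W i)‖ ^ 2
        ≤ L ^ 2 * (2 * (η ^ 2 * ‖rowMean s.G‖ ^ 2) + 2 * ‖s.W i - rowMean s.X‖ ^ 2) := fun i => by
      refine ((hf i).norm_gradient_sub_sq_le hL _ _).trans ?_
      gcongr
      refine (norm_sub_sq_le_two_mul _ _ (rowMean s.X)).trans_eq ?_
      rw [hs', rowMean_iter_Y f θ β γ η X₀ v₀ hC, sub_sub_cancel, norm_smul, mul_pow,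
        Real.norm_eq_abs, sq_abs, norm_sub_rev (s.W i)]
    refine (Finset.sum_le_sum fun i _ => h4 i).trans_eq ?_
    rw [← Finset.mul_sum, Finset.sum_add_distrib, ← Finset.mul_sum, Finset.sum_const,
      Finset.card_univ, Fintype.card_fin, nsmul_eq_mul]
    rw [← Finset.mul_sum]
    ring
  have h5 : b ≤ (1 - τ) * (2 * By + 2 * Bc) + τ * (2 * Bs' + 2 * Bs) := by
    have := mul_le_mul_of_nonneg_left h1 (sub_nonneg.2 hτ1)
    have := mul_le_mul_of_nonneg_left h2 hτ0.le
    linarith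
  have hb0 : 0 ≤ b := sq_nonneg _
  clear_value By Bs Bs' Bc E b a a' τ
  have h6 : a ^ 2 * b ≤ a' ^ 2 * b := by gcongr
  have h7 := mul_le_mul_of_nonneg_left h5 (sq_nonneg a')
  -- Since α² τ = θ α is linear in α, going back from k + 1 to k costs only 5/4 here; `h9` has to
  -- pay 25/16.
  have h8 : a' ^ 2 * τ * Bs ≤ 5 / 4 * (a ^ 2 * tau β γ k * Bs) := by
    have e1 : a' ^ 2 * τ = θ * a' := by linear_combination a' * haτ'
    have e2 : a ^ 2 * tau β γ k = θ * a := by linear_combination a * haτ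
    rw [e1, e2]
    have := mul_le_mul_of_nonneg_right (mul_le_mul_of_nonneg_left haa' hθ.le) hBs0
    linarith
  have h9 : a' ^ 2 * ((1 - τ) * Bc) ≤ 25 / 16 * a ^ 2 * Bc := by
    have e1 : a' ^ 2 ≤ 25 / 16 * a ^ 2 := by nlinarith
    have e2 : (1 - τ) * Bc ≤ Bc := mul_le_of_le_one_left hBc0 (by linarith)
    gcongr
  have h10 := mul_le_mul_of_nonneg_left h3 (by positivity : 0 ≤ 25 / 16 * a ^ 2)
  linarith

end Iterates


open Matrix

/-! ### Convergence rate -/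

section Rate

variable {n d : ℕ} {f : Fin n → EuclideanSpace ℝ (Fin d) → ℝ} {C Ct : Matrix (Fin n) (Fin n) ℝ}
  {p : Fin n → ℝ} {β γ δ κ η L : ℝ} {X₀ : RowMat n d} {v₀ : Fin n → ℝ}
  {xs : EuclideanSpace ℝ (Fin d)}

lemma sum_range_le_sum_range_succ {a : ℕ → ℝ} (ha : ∀ k, 0 ≤ a k) (m : ℕ) :
    ∑ k ∈ Finset.range m, a k ≤ ∑ k ∈ Finset.range (m + 1), a k := by
  rw [Finset.sum_range_succ]; linarith [ha m]

lemma sum_range_shift_le {a : ℕ → ℝ} (ha : ∀ k, 0 ≤ a k) (m : ℕ) :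
    ∑ k ∈ Finset.range m, a (k + 1) ≤ ∑ k ∈ Finset.range (m + 1), a k := by
  rw [Finset.sum_range_succ']; linarith [ha 0]

/-- The rate for scalar sequences that satisfy the recursions of the algorithm: `x`, `z`, `g` are
the consensus errors of `X`, `τ Z`, `G`, `b` is the change of the gradients, `x'`, `z'`, `r` are the
(damped) norms of the averages, `F`, `D` the optimization errors, and `o`, `G` the consensus error
and the optimality gap of the output. -/
lemma weighted_gap_le_of_recursions {L N ν κ a₀ δ β η o G : ℝ}
    {α τ x z g b x' z' r E By Bs F D : ℕ → ℝ} (hL : 0 < L) (hN : 0 < N) (hδ : 0 < δ)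
    (hδ1 : δ ≤ 1) (hβ : 0 ≤ β) (hβ1 : β ≤ 1 / 4) (hη : 0 < η)
    (hα0 : 0 < α 0) (hαe : ∀ k : ℕ, α k = α 0 * (1 + β * k))
    (hαs : ∀ k, (1 - τ (k + 1)) * α (k + 1) ^ 2 ≤ α k ^ 2)
    (hτ0 : ∀ k, 0 < τ k) (hτ1 : ∀ k, τ k ≤ 1)
    (hx0 : ∀ k, 0 ≤ x k) (hz0 : ∀ k, 0 ≤ z k) (hg0 : ∀ k, 0 ≤ g k) (hx'0 : ∀ k, 0 ≤ x' k)
    (hz'0 : ∀ k, 0 ≤ z' k) (hr0 : ∀ k, 0 ≤ r k) (hE0 : ∀ k, 0 ≤ E k) (hBy0 : ∀ k, 0 ≤ By k)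
    (hBs0 : ∀ k, 0 ≤ Bs k) (hF0 : ∀ k, 0 ≤ F k) (hD0 : ∀ k, 0 ≤ D k)
    (hxr : ∀ k, x (k + 1) ≤ (1 - δ) * (x k + η * g k) + z (k + 1))
    (hzr : ∀ k, z (k + 1) ≤ (1 - δ) * (z k + 1 / 4 * η * g k))
    (hgr : ∀ k, g (k + 1) ≤ (1 - δ) * g k + b k)
    (hxr' : ∀ k, x' (k + 1) ≤ (1 - δ) * (x' k + η * r k) + z' (k + 1))
    (hzr' : ∀ k, z' (k + 1) ≤ (1 - δ) * (z' k + 1 / 4 * η * r k))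
    (hbk : ∀ k, α k ^ 2 * b k ^ 2
      ≤ 2 * (α (k + 1) ^ 2 * ((1 - τ (k + 1)) * By (k + 1) + τ (k + 1) * Bs (k + 1)))
        + 5 / 2 * (α k ^ 2 * (τ k * Bs k))
        + 25 / 4 * L ^ 2 * (N * η ^ 2 * (α k ^ 2 * r k ^ 2) + α k ^ 2 * E k))
    (hE1 : ∀ k, E k ≤ 2 * ν ^ 2 * κ ^ 2 * (x k ^ 2 + (a₀ * x' k) ^ 2))
    (hstep : ∀ k, α k ^ 2 * F (k + 1) + 1 / 4 / (2 * η) * D (k + 1)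
      ≤ (1 - τ k) * α k ^ 2 * F k + 1 / 4 / (2 * η) * D k
        + (-(η * (1 - L * η - 1 / 8)) * (α k ^ 2 * r k ^ 2) + L / N * (α k ^ 2 * E k)
          - 1 / (2 * L * N) * (α k ^ 2 * ((1 - τ k) * By k + τ k * Bs k))))
    (m : ℕ)
    (hout : o ≤ 2 * ν ^ 2 * κ ^ 2 * ((x m + η * g m) ^ 2 + (a₀ * (x' m + η * r m)) ^ 2))
    (hgap : G ≤ 2 * F (m + 1) + L / N * o)
    (hs1 : ν ^ 2 * κ ^ 2 * η ^ 2 * L ^ 2 ≤ 1 / 100000 * δ ^ 8)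
    (hs2 : a₀ ^ 2 * ν ^ 2 * κ ^ 2 * η * L ≤ 1 / 100000 * (N * δ ^ 6))
    (hs3 : η * L ≤ 1 / 2) :
    α m ^ 2 * G
      ≤ 2 * ((1 - τ 0) * α 0 ^ 2 * F 0 + 1 / 4 / (2 * η) * D 0)
        + 30 * (L / N) * ν ^ 2 * κ ^ 2 / δ ^ 3
          * (α 0 ^ 2 * (x 0 + 2 / δ * z 0 + 5 / 4 * η / δ ^ 2 * g 0) ^ 2
            + a₀ ^ 2 * (α 0 ^ 2 * (x' 0 + 2 / δ * z' 0) ^ 2)) := by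
  have hB0 : ∀ k, 0 ≤ α k ^ 2 * ((1 - τ k) * By k + τ k * Bs k) := fun k =>
    mul_nonneg (sq_nonneg _) (add_nonneg (mul_nonneg (sub_nonneg.2 (hτ1 k)) (hBy0 k))
      (mul_nonneg (hτ0 k).le (hBs0 k)))
  have hSS := sum_consensus_le hδ hδ1 hβ hβ1 hη hα0 hαe hx0 hz0 hg0 hxr hzr hgr m
  have hST := sum_average_le hδ hδ1 hβ hβ1 hη hα0 hαe hx'0 hz'0 hr0 hxr' hzr' m
  obtain ⟨S, hS⟩ : ∃ S : ℕ → ℝ, ∀ k, S k = x k + 2 / δ * z k + 5 / 4 * η / δ ^ 2 * g k :=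
    ⟨_, fun _ => rfl⟩
  obtain ⟨T, hT⟩ : ∃ T : ℕ → ℝ, ∀ k, T k = x' k + 2 / δ * z' k := ⟨_, fun _ => rfl⟩
  simp only [← hS, ← hT] at hSS hST ⊢
  -- As δ ≤ 1, the potential dominates x + η g, so its value at m also controls the consensus error
  -- of the output with index m + 1.
  have hxS : ∀ k, x k + η * g k ≤ S k := fun k => by
    have h1 : η * g k ≤ 5 / 4 * η / δ ^ 2 * g k := by
      have := hg0 k
      gcongr
      rw [le_div_iff₀ (by positivity)]
      nlinarith [pow_le_one₀ hδ.le hδ1 (n := 2)]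
    have h2 : 0 ≤ 2 / δ * z k := mul_nonneg (by positivity) (hz0 k)
    rw [hS]; linarith
  have hxT : ∀ k, x' k ≤ T k := fun k => by
    have : 0 ≤ 2 / δ * z' k := mul_nonneg (by positivity) (hz'0 k)
    rw [hT]; linarith
  have hxS' : ∀ k, x k ≤ S k := fun k => by
    have := mul_nonneg hη.le (hg0 k)
    linarith [hxS k]
  have hEle : ∀ k, E k ≤ 2 * ν ^ 2 * κ ^ 2 * (S k ^ 2 + a₀ ^ 2 * T k ^ 2) := fun k => by
    refine (hE1 k).trans ?_
    rw [mul_pow]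
    have := hx0 k
    have := hx'0 k
    gcongr
    · exact hxS' k
    · exact hxT k
  have htel := telescope_le hF0 hαs hstep m
  rw [Finset.sum_sub_distrib, Finset.sum_add_distrib, ← Finset.mul_sum, ← Finset.mul_sum,
    ← Finset.mul_sum] at htel
  have hDm : 0 ≤ 1 / 4 / (2 * η) * D (m + 1) :=
    mul_nonneg (by positivity) (hD0 _)
  have hS0 : ∀ k, 0 ≤ S k := fun k => (hx0 k).trans (hxS' k)
  have hT0 : ∀ k, 0 ≤ T k := fun k => (hx'0 k).trans (hxT k)
  have hαS : α m ^ 2 * S m ^ 2 ≤ ∑ k ∈ Finset.range (m + 1), α k ^ 2 * S k ^ 2 :=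
    Finset.single_le_sum (f := fun k => α k ^ 2 * S k ^ 2) (fun k _ => by positivity)
      (Finset.self_mem_range_succ m)
  have hαT : α m ^ 2 * T m ^ 2 ≤ ∑ k ∈ Finset.range (m + 1), α k ^ 2 * T k ^ 2 :=
    Finset.single_le_sum (f := fun k => α k ^ 2 * T k ^ 2) (fun k _ => by positivity)
      (Finset.self_mem_range_succ m)
  have hαr : α m ^ 2 * r m ^ 2 ≤ ∑ k ∈ Finset.range (m + 1), α k ^ 2 * r k ^ 2 :=
    Finset.single_le_sum (f := fun k => α k ^ 2 * r k ^ 2) (fun k _ => by positivity)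
      (Finset.self_mem_range_succ m)
  have hout' : α m ^ 2 * o ≤ 2 * ν ^ 2 * κ ^ 2 * (∑ k ∈ Finset.range (m + 1), α k ^ 2 * S k ^ 2
      + a₀ ^ 2 * (2 * ∑ k ∈ Finset.range (m + 1), α k ^ 2 * T k ^ 2
        + 2 * η ^ 2 * ∑ k ∈ Finset.range (m + 1), α k ^ 2 * r k ^ 2)) := by
    have h1 : o ≤ 2 * ν ^ 2 * κ ^ 2
        * (S m ^ 2 + a₀ ^ 2 * (2 * T m ^ 2 + 2 * η ^ 2 * r m ^ 2)) := by
      refine hout.trans ?_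
      have h2 := pow_le_pow_left₀ (add_nonneg (hx0 m) (mul_nonneg hη.le (hg0 m))) (hxS m) 2
      have h3 : (x' m + η * r m) ^ 2 ≤ 2 * T m ^ 2 + 2 * η ^ 2 * r m ^ 2 := by
        have h4 := pow_le_pow_left₀ (hx'0 m) (hxT m) 2
        have h5 := add_sq_le (a := x' m) (b := η * r m)
        rw [mul_pow] at h5
        linarith
      rw [mul_pow]
      gcongr
    calc α m ^ 2 * o ≤ α m ^ 2 *
          (2 * ν ^ 2 * κ ^ 2 * (S m ^ 2 + a₀ ^ 2 * (2 * T m ^ 2 + 2 * η ^ 2 * r m ^ 2))) :=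
          mul_le_mul_of_nonneg_left h1 (sq_nonneg _)
      _ = 2 * ν ^ 2 * κ ^ 2 * (α m ^ 2 * S m ^ 2
          + a₀ ^ 2 * (2 * (α m ^ 2 * T m ^ 2) + 2 * η ^ 2 * (α m ^ 2 * r m ^ 2))) := by ring
      _ ≤ _ := by gcongr
  have hgap' : α m ^ 2 * G ≤ 2 * (α m ^ 2 * F (m + 1)) + L / N * (α m ^ 2 * o) := by
    refine (mul_le_mul_of_nonneg_left hgap (sq_nonneg (α m))).trans_eq ?_
    ring
  have hSE : ∑ k ∈ Finset.range (m + 1), α k ^ 2 * E k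
      ≤ 2 * ν ^ 2 * κ ^ 2 * (∑ k ∈ Finset.range (m + 1), α k ^ 2 * S k ^ 2
        + a₀ ^ 2 * ∑ k ∈ Finset.range (m + 1), α k ^ 2 * T k ^ 2) := by
    rw [Finset.mul_sum (f := fun k => α k ^ 2 * T k ^ 2), ← Finset.sum_add_distrib,
      Finset.mul_sum]
    refine Finset.sum_le_sum fun k _ => ?_
    refine (mul_le_mul_of_nonneg_left (hEle k) (sq_nonneg (α k))).trans_eq ?_
    ring
  have hSb : ∑ k ∈ Finset.range m, α k ^ 2 * b k ^ 2
      ≤ 9 / 2 * ∑ k ∈ Finset.range (m + 1), α k ^ 2 * ((1 - τ k) * By k + τ k * Bs k)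
        + 25 / 4 * L ^ 2 * (N * η ^ 2 * ∑ k ∈ Finset.range (m + 1), α k ^ 2 * r k ^ 2
          + ∑ k ∈ Finset.range (m + 1), α k ^ 2 * E k) := by
    have h1 := Finset.sum_le_sum fun k (_ : k ∈ Finset.range m) =>
      hbk k
    refine h1.trans ?_
    simp only [Finset.sum_add_distrib, ← Finset.mul_sum]
    have h2 := sum_range_shift_le hB0 m
    have h3 : ∑ k ∈ Finset.range m, α k ^ 2 * (τ k * Bs k)
        ≤ ∑ k ∈ Finset.range (m + 1), α k ^ 2 * ((1 - τ k) * By k + τ k * Bs k) := by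
      refine le_trans (Finset.sum_le_sum fun k _ => ?_) (sum_range_le_sum_range_succ hB0 m)
      have := mul_nonneg (sub_nonneg.2 (hτ1 k)) (hBy0 k)
      gcongr
      linarith
    have h4 := sum_range_le_sum_range_succ (a := fun k => α k ^ 2 * r k ^ 2)
      (fun k => by positivity) m
    have h5 := sum_range_le_sum_range_succ (a := fun k => α k ^ 2 * E k)
      (fun k => mul_nonneg (sq_nonneg _) (hE0 k)) m
    calc _ ≤ 2 * ∑ k ∈ Finset.range (m + 1), α k ^ 2 * ((1 - τ k) * By k + τ k * Bs k)
          + 5 / 2 * ∑ k ∈ Finset.range (m + 1), α k ^ 2 * ((1 - τ k) * By k + τ k * Bs k)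
          + 25 / 4 * L ^ 2 * (N * η ^ 2 * ∑ k ∈ Finset.range (m + 1), α k ^ 2 * r k ^ 2
            + ∑ k ∈ Finset.range (m + 1), α k ^ 2 * E k) := by
          gcongr
      _ = _ := by ring
  have hST' : ∑ k ∈ Finset.range (m + 1), α k ^ 2 * T k ^ 2
      ≤ 3 / δ ^ 3 * (α 0 ^ 2 * T 0 ^ 2)
        + 4 * η ^ 2 / δ ^ 6 * ∑ k ∈ Finset.range (m + 1), α k ^ 2 * r k ^ 2 := by
    refine hST.trans ?_
    gcongr
    exact Nat.le_succ m
  exact absorb_errors hL hN hδ hη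
    (Finset.sum_nonneg fun k _ => mul_nonneg (sq_nonneg _) (hE0 k))
    (Finset.sum_nonneg fun k _ => by positivity)
    (Finset.sum_nonneg fun k _ => hB0 k)
    (by positivity) (by positivity) hSE hSS hST' hSb (by linarith) hout' hgap' hs1 hs2 hδ1 hs3

/-- The weighted optimality gap is bounded in terms of the initial errors. -/
lemma weighted_outputGap_le (hn : 0 < n) (hL : 0 < L) (hf : ∀ i, IsConvexSmooth L (f i))
    (hxs : ∀ x, avgObj f xs ≤ avgObj f x) (hC : IsRegularColStochastic C)
    (hv : ∀ i, 0 < v₀ i) (hvs : ∑ i, v₀ i = n) (hγ : 0 < γ) (hγ1 : γ ≤ 1) (hβ : 0 < β)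
    (hβγ : β ≤ γ / 4) (hp : IsPerronVector C p) (hδ : 0 < δ) (h : IsAdaptedNorm C p δ Ct κ)
    (hη : 0 < η)
    (hs1 : vInvBound C v₀ ^ 2 * κ ^ 2 * η ^ 2 * L ^ 2 ≤ 1 / 100000 * δ ^ 8)
    (hs2 : vecNorm Ct (v₀ - p) ^ 2 * vInvBound C v₀ ^ 2 * κ ^ 2 * η * L
      ≤ 1 / 100000 * (n * δ ^ 6))
    (hs3 : η * L ≤ 1 / 2) (m : ℕ) :
    alpha (1 / 4) β γ m ^ 2 * outputGap f C (1 / 4) β γ η X₀ v₀ xs (m + 1)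
      ≤ 2 * ((1 - tau β γ 0) * alpha (1 / 4) β γ 0 ^ 2
          * (avgObj f (rowMean X₀) - avgObj f xs) + 1 / 4 / (2 * η) * ‖rowMean X₀ - xs‖ ^ 2)
        + 30 * (L / n) * vInvBound C v₀ ^ 2 * κ ^ 2 / δ ^ 3
          * (alpha (1 / 4) β γ 0 ^ 2 * (colNorm (vecNorm Ct) (mix (conMat p) X₀)
              + 2 / δ * (tau β γ 0 * colNorm (vecNorm Ct) (mix (conMat p) X₀))
              + 5 / 4 * η / δ ^ 2
                * colNorm (vecNorm Ct) (mix (conMat p) (gradF f (invScale v₀ X₀)))) ^ 2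
            + vecNorm Ct (v₀ - p) ^ 2 * (alpha (1 / 4) β γ 0 ^ 2
              * (‖rowMean X₀‖ + 2 / δ * (tau β γ 0 * ‖rowMean X₀‖)) ^ 2)) := by
  have hCs := hC.colStochastic
  have hn' : (0 : ℝ) < n := by exact_mod_cast hn
  have hθ : (0 : ℝ) < 1 / 4 := by norm_num
  have hδ1 := h.gap_le_one
  have hq0 : 0 ≤ 1 - δ := by linarith
  have hq1 : 1 - δ ≤ 1 := by linarith
  have hβ1 : β ≤ 1 / 4 := by linarith
  set ν := vInvBound C v₀
  set s := iter f C (1 / 4) β γ η X₀ v₀ with hs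
  set α := alpha (1 / 4) β γ with hα
  set τ := tau β γ with hτ
  set a₀ := vecNorm Ct (v₀ - p)
  have hα0 : ∀ k, 0 < α k := fun k => alpha_pos hθ hγ hβ k
  have hτ0 : ∀ k, 0 < τ k := fun k => tau_pos hγ hβ k
  have hτ1 : ∀ k, τ k ≤ 1 := fun k => tau_le_one hγ1 hβ k
  have hvk : ∀ k i, 0 < (s k).v i ∧ ((s k).v i)⁻¹ ≤ ν := fun k i => by
    rw [hs, iter_v]; exact iterate_pos_and_inv_le hC hp hv k i
  have hvp : ∀ k, vecNorm Ct ((s k).v - p) ≤ (1 - δ) ^ k * a₀ := fun k => by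
    rw [hs, iter_v]; exact h.vecNorm_iterate_sub_le hCs hp hvs k
  -- consensus errors, averages and descent terms as scalar sequences
  set x : ℕ → ℝ := fun k => colNorm (vecNorm Ct) (mix (conMat p) (s k).X) with hx
  set z : ℕ → ℝ := fun k => τ k * colNorm (vecNorm Ct) (mix (conMat p) (s k).Z) with hz
  set g : ℕ → ℝ := fun k => colNorm (vecNorm Ct) (mix (conMat p) (s k).G) with hg
  set b : ℕ → ℝ := fun k => colNorm euclNorm (gradF f (s (k + 1)).W - gradF f (s k).W) with hb
  -- Norms of averages enter the error only multiplied by ‖v_k - p‖_C ≤ (1 - δ)^k a₀. With this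
  -- factor built in they satisfy contracting recursions, and no bound on the iterates is needed.
  set x' : ℕ → ℝ := fun k => (1 - δ) ^ k * ‖rowMean (s k).X‖ with hx'
  set z' : ℕ → ℝ := fun k => (1 - δ) ^ k * (τ k * ‖rowMean (s k).Z‖) with hz'
  set r : ℕ → ℝ := fun k => ‖rowMean (s k).G‖ with hr
  set E : ℕ → ℝ := fun k => ∑ i, ‖(s k).W i - rowMean (s k).X‖ ^ 2 with hE
  set By : ℕ → ℝ := fun k =>
    ∑ i, ‖∇ (f i) (rowMean (s k).Y) - ∇ (f i) ((s k).W i)‖ ^ 2 with hBy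
  set Bs : ℕ → ℝ := fun k => ∑ i, ‖∇ (f i) xs - ∇ (f i) ((s k).W i)‖ ^ 2 with hBs
  set F : ℕ → ℝ := fun k => avgObj f (rowMean (s k).Y) - avgObj f xs with hF
  set D : ℕ → ℝ := fun k => ‖rowMean (s k).Z - xs‖ ^ 2 with hD
  have hx0 : ∀ k, 0 ≤ x k := fun k => colNorm_nonneg _ _
  have hz0 : ∀ k, 0 ≤ z k := fun k => mul_nonneg (hτ0 k).le (colNorm_nonneg _ _)
  have hg0 : ∀ k, 0 ≤ g k := fun k => colNorm_nonneg _ _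
  have hx'0 : ∀ k, 0 ≤ x' k := fun k => mul_nonneg (pow_nonneg hq0 k) (norm_nonneg _)
  have hz'0 : ∀ k, 0 ≤ z' k := fun k =>
    mul_nonneg (pow_nonneg hq0 k) (mul_nonneg (hτ0 k).le (norm_nonneg _))
  have hr0 : ∀ k, 0 ≤ r k := fun k => norm_nonneg _
  have hE0 : ∀ k, 0 ≤ E k := fun k => Finset.sum_nonneg fun _ _ => sq_nonneg _
  have hBy0 : ∀ k, 0 ≤ By k := fun k => Finset.sum_nonneg fun _ _ => sq_nonneg _
  have hBs0 : ∀ k, 0 ≤ Bs k := fun k => Finset.sum_nonneg fun _ _ => sq_nonneg _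
  have hYx : ∀ k, colNorm (vecNorm Ct) (mix (conMat p) (s (k + 1)).Y)
      ≤ (1 - δ) * (x k + η * g k) := fun k => consensus_Y_le f _ β γ X₀ v₀ hn hCs hp h hη.le k
  have hYr : ∀ k, ‖rowMean (s (k + 1)).Y‖ ≤ ‖rowMean (s k).X‖ + η * r k := fun k =>
    average_Y_le f X₀ v₀ hCs hη.le k
  have hstep : ∀ k, α k ^ 2 * F (k + 1) + 1 / 4 / (2 * η) * D (k + 1)
      ≤ (1 - τ k) * α k ^ 2 * F k + 1 / 4 / (2 * η) * D k
        + (-(η * (1 - L * η - 1 / 8)) * (α k ^ 2 * r k ^ 2) + L / n * (α k ^ 2 * E k)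
          - 1 / (2 * L * n) * (α k ^ 2 * ((1 - τ k) * By k + τ k * Bs k))) := fun k => by
    have h1 := accelerated_step hL hn hf xs (rowMean (s k).Y) (rowMean (s k).Z) (s k).W
      (hτ0 k).le (hτ1 k) (alpha_mul_tau (1 / 4) hγ hβ k) hη
      (rowMean_iter_X f (1 / 4) β γ η X₀ v₀ k) (rowMean_iter_G f (1 / 4) β γ η X₀ v₀ hCs k)
    rw [← rowMean_iter_Y f (1 / 4) β γ η X₀ v₀ hCs k,
      ← rowMean_iter_Z f (1 / 4) β γ η X₀ v₀ hCs k] at h1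
    refine h1.trans_eq ?_
    simp only [hF, hD, hr, hE, hBy, hBs, hs]
    ring
  have hE1 : ∀ k, E k ≤ 2 * ν ^ 2 * κ ^ 2 * (x k ^ 2 + (a₀ * x' k) ^ 2) := fun k => by
    refine (h.sum_invScale_sub_le (fun i => (hvk k i).1) (fun i => (hvk k i).2) (s k).X).trans ?_
    have h1 : vecNorm Ct ((s k).v - p) * ‖rowMean (s k).X‖ ≤ a₀ * x' k :=
      calc _ ≤ (1 - δ) ^ k * a₀ * ‖rowMean (s k).X‖ :=
            mul_le_mul_of_nonneg_right (hvp k) (norm_nonneg _)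
        _ = a₀ * x' k := by simp only [hx']; ring
    have h2 := pow_le_pow_left₀ (mul_nonneg (vecNorm_nonneg _ _) (norm_nonneg _)) h1 2
    exact mul_le_mul_of_nonneg_left (add_le_add le_rfl h2) (by positivity)
  obtain ⟨o, ho⟩ : ∃ o, o = ∑ i, ‖output f C (1 / 4) β γ η X₀ v₀ (m + 1) i
    - rowMean (s (m + 1)).Y‖ ^ 2 := ⟨_, rfl⟩
  have hgap : outputGap f C (1 / 4) β γ η X₀ v₀ xs (m + 1) ≤ 2 * F (m + 1) + L / n * o := by
    have h2 := Finset.sum_le_sum fun i (_ : i ∈ Finset.univ) => avgObj_gap_le hL hn hf hxs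
      (rowMean (s (m + 1)).Y) (output f C (1 / 4) β γ η X₀ v₀ (m + 1) i)
    rw [Finset.sum_sub_distrib, Finset.sum_add_distrib, ← Finset.mul_sum,
      ← Finset.mul_sum, ← ho] at h2
    simp only [Finset.sum_const, Finset.card_univ, Fintype.card_fin, nsmul_eq_mul] at h2
    have h3 := mul_le_mul_of_nonneg_left h2 (by positivity : 0 ≤ 1 / (n : ℝ))
    rw [outputGap]
    refine le_of_sub_nonneg ((sub_nonneg.2 h3).trans_eq ?_)
    simp only [hF]
    field_simp
  have hout : o ≤ 2 * ν ^ 2 * κ ^ 2 * ((x m + η * g m) ^ 2 + (a₀ * (x' m + η * r m)) ^ 2) := by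
    rw [ho]
    refine (h.sum_invScale_sub_le (fun i => (hvk (m + 1) i).1) (fun i => (hvk (m + 1) i).2)
      (s (m + 1)).Y).trans ?_
    have h2 : colNorm (vecNorm Ct) (mix (conMat p) (s (m + 1)).Y) ≤ x m + η * g m :=
      (hYx m).trans
        (mul_le_of_le_one_left (add_nonneg (hx0 m) (mul_nonneg hη.le (hg0 m))) hq1)
    have h3 : vecNorm Ct ((s (m + 1)).v - p) * ‖rowMean (s (m + 1)).Y‖
        ≤ a₀ * (x' m + η * r m) := by
      have h5 : (1 - δ) ^ (m + 1) * ‖rowMean (s m).X‖ ≤ x' m :=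
        mul_le_mul_of_nonneg_right (pow_le_pow_of_le_one hq0 hq1 (Nat.le_succ m))
          (norm_nonneg _)
      have h6 : (1 - δ) ^ (m + 1) * (η * r m) ≤ η * r m :=
        mul_le_of_le_one_left (mul_nonneg hη.le (hr0 m)) (pow_le_one₀ hq0 hq1)
      calc _ ≤ (1 - δ) ^ (m + 1) * a₀ * (‖rowMean (s m).X‖ + η * r m) :=
            mul_le_mul (hvp _) (hYr m) (norm_nonneg _)
              (mul_nonneg (pow_nonneg hq0 _) (vecNorm_nonneg _ _))
        _ = a₀ * ((1 - δ) ^ (m + 1) * ‖rowMean (s m).X‖ + (1 - δ) ^ (m + 1) * (η * r m)) := by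
            ring
        _ ≤ _ := mul_le_mul_of_nonneg_left (add_le_add h5 h6) (vecNorm_nonneg _ _)
    exact mul_le_mul_of_nonneg_left (add_le_add
      (pow_le_pow_left₀ (colNorm_nonneg _ _) h2 2)
      (pow_le_pow_left₀ (mul_nonneg (vecNorm_nonneg _ _) (norm_nonneg _)) h3 2)) (by positivity)
  have hbk : ∀ k, α k ^ 2 * b k ^ 2
      ≤ 2 * (α (k + 1) ^ 2 * ((1 - τ (k + 1)) * By (k + 1) + τ (k + 1) * Bs (k + 1)))
        + 5 / 2 * (α k ^ 2 * (τ k * Bs k))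
        + 25 / 4 * L ^ 2 * (n * η ^ 2 * (α k ^ 2 * r k ^ 2) + α k ^ 2 * E k) := fun k =>
    weighted_gradient_change_le X₀ v₀ hL hf hCs hθ hγ hγ1 hβ hβ1 xs k
  have hxr : ∀ k, x (k + 1) ≤ (1 - δ) * (x k + η * g k) + z (k + 1) := fun k =>
    (consensus_X_le f X₀ v₀ hγ hγ1 hβ (k + 1)).trans (add_le_add (hYx k) le_rfl)
  have hzr : ∀ k, z (k + 1) ≤ (1 - δ) * (z k + 1 / 4 * η * g k) := fun k =>
    consensus_Z_le f X₀ v₀ hn hCs hp h hη.le hθ hγ hβ k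
  have hgr : ∀ k, g (k + 1) ≤ (1 - δ) * g k + b k := fun k =>
    consensus_G_le f X₀ v₀ hn hCs hp h k
  have hxr' : ∀ k, x' (k + 1) ≤ (1 - δ) * (x' k + η * r k) + z' (k + 1) := fun k => by
    have h1 : ‖rowMean (s (k + 1)).X‖ ≤ (‖rowMean (s k).X‖ + η * r k)
        + τ (k + 1) * ‖rowMean (s (k + 1)).Z‖ :=
      (average_X_le f X₀ v₀ hγ hγ1 hβ (k + 1)).trans (by gcongr; exact hYr k)
    have h2 := mul_le_mul_of_nonneg_left h1 (pow_nonneg hq0 (k + 1))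
    -- The damping of the average gradient is given away, because `r` is to be absorbed by the
    -- undamped descent term.
    have h3 : (1 - δ) * ((1 - δ) ^ k * (η * r k)) ≤ (1 - δ) * (1 * (η * r k)) := by
      have := hr0 k
      gcongr
      exact pow_le_one₀ hq0 hq1
    simp only [hx', hz']
    refine h2.trans ?_
    rw [pow_succ']
    linarith
  have hzr' : ∀ k, z' (k + 1) ≤ (1 - δ) * (z' k + 1 / 4 * η * r k) := fun k => by
    have h1 := mul_le_mul_of_nonneg_left
      (average_Z_le f X₀ v₀ hCs hη.le hθ hγ hβ k) (pow_nonneg hq0 (k + 1))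
    have h3 : (1 - δ) * ((1 - δ) ^ k * (1 / 4 * η * r k))
        ≤ (1 - δ) * (1 * (1 / 4 * η * r k)) := by
      have := hr0 k
      gcongr
      exact pow_le_one₀ hq0 hq1
    simp only [hz']
    refine h1.trans ?_
    rw [pow_succ']
    linarith
  have hαs : ∀ k, (1 - τ (k + 1)) * α (k + 1) ^ 2 ≤ α k ^ 2 := fun k =>
    one_sub_tau_mul_alpha_sq_le hθ hγ hβ hβγ k
  have hαe : ∀ k : ℕ, α k = α 0 * (1 + β * k) := fun k => alpha_eq (1 / 4) β γ k
  have hF0 : ∀ k, 0 ≤ F k := fun k => sub_nonneg.2 (hxs _)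
  have hD0 : ∀ k, 0 ≤ D k := fun k => sq_nonneg _
  have hfin := weighted_gap_le_of_recursions hL hn' hδ hδ1 hβ.le hβ1 hη (hα0 0) hαe hαs hτ0 hτ1
    hx0 hz0 hg0 hx'0 hz'0 hr0 hE0 hBy0 hBs0 hF0 hD0 hxr hzr hgr hxr' hzr' hbk hE1 hstep m
    hout hgap hs1 hs2 hs3
  have e1 : x' 0 = ‖rowMean X₀‖ := one_mul _
  have e2 : z' 0 = τ 0 * ‖rowMean X₀‖ := one_mul _
  rw [e1, e2] at hfin
  exact hfin

end Rate

/-! ### Constants -/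

section Constants

variable {n d : ℕ} {δ κ η L ν a : ℝ}

lemma cOne_ge (hδ : 0 < δ) : 3 / 4 ≤ cOne (1 / 4) δ := by
  unfold cOne; nlinarith [sq_nonneg δ]

lemma cTwo_ge : 26 ≤ cTwo := by
  have : (1 : ℝ) ≤ √(Real.exp 1) := Real.one_le_sqrt.2 (Real.one_le_exp zero_le_one)
  unfold cTwo; linarith

/-- Here √θ = 1/2, and c₁ ≥ 3/4, c₂ ≥ 26 push the number under the root above 25000; squaring yields
1/(4 · 25000). -/
lemma StepCond₁.sq_le (hL : 0 < L) (hδ : 0 < δ) (hκ : 0 < κ) (hν : 0 < ν)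
    (h : StepCond₁ n L (1 / 4) δ κ ν a η) :
    ν ^ 2 * κ ^ 2 * η ^ 2 * L ^ 2 ≤ 1 / 100000 * δ ^ 8 := by
  have h1 := h.le₁
  have hc1 := cOne_ge hδ
  have hc2 := cTwo_ge
  set Q := 96 * (15 + 9 * (1 / 4)) * cOne (1 / 4) δ * cTwo with hQ
  have hQ0 : 25000 ≤ Q := by
    have h2 : 3 / 4 * 26 ≤ cOne (1 / 4) δ * cTwo := by gcongr
    rw [hQ]; linarith
  have hs : √(1 / 4 : ℝ) = 1 / 2 := by
    rw [show (1 / 4 : ℝ) = (1 / 2) ^ 2 by norm_num]; exact Real.sqrt_sq (by norm_num)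
  have hQs : 0 < √Q := Real.sqrt_pos.2 (by linarith)
  rw [hs, le_div_iff₀ (by positivity)] at h1
  have h3 := pow_le_pow_left₀ (mul_nonneg h.pos.le (by positivity)) h1 2
  have e1 : (η * (√Q * κ * ν * L)) ^ 2 = Q * (ν ^ 2 * κ ^ 2 * η ^ 2 * L ^ 2) := by
    have := Real.sq_sqrt (by linarith : 0 ≤ Q)
    calc _ = √Q ^ 2 * (ν ^ 2 * κ ^ 2 * η ^ 2 * L ^ 2) := by ring
      _ = _ := by rw [this]
  rw [e1] at h3
  have h4 : 25000 * (ν ^ 2 * κ ^ 2 * η ^ 2 * L ^ 2) ≤ (1 / 2 * δ ^ 4) ^ 2 :=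
    le_trans (by gcongr) h3
  have e2 : (1 / 2 * δ ^ 4) ^ 2 = 1 / 4 * δ ^ 8 := by ring
  linarith

/-- 1920 (1 + θ)² = 3000 and c₂ ≥ 26, so even 1/(4 · 3000 · 26) would do as the constant. -/
lemma StepCond₁.sq_dist_le (hL : 0 < L) (h : StepCond₁ n L (1 / 4) δ κ ν a η) :
    a ^ 2 * ν ^ 2 * κ ^ 2 * η * L ≤ 1 / 100000 * (n * δ ^ 6) := by
  have h1 := h.le₂
  have hη := h.pos
  have e : η * (1920 * a ^ 2 * κ ^ 2 * ν ^ 2 * (1 + 1 / 4) ^ 2 * cTwo * L)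
      = 3000 * cTwo * (a ^ 2 * ν ^ 2 * κ ^ 2 * η * L) := by ring
  rw [e] at h1
  have hc2 := cTwo_ge
  have h2 : 0 ≤ a ^ 2 * ν ^ 2 * κ ^ 2 * η * L := by positivity
  have h3 : 3000 * 26 * (a ^ 2 * ν ^ 2 * κ ^ 2 * η * L)
      ≤ 3000 * cTwo * (a ^ 2 * ν ^ 2 * κ ^ 2 * η * L) := by gcongr
  linarith

lemma StepCond₁.mul_le (hL : 0 < L) (h : StepCond₁ n L (1 / 4) δ κ ν a η) :
    η * L ≤ 1 / 2 := by
  have h1 := h.le₃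
  rw [le_div_iff₀ (by positivity)] at h1
  linarith

variable {β γ : ℝ} {Ct : Matrix (Fin n) (Fin n) ℝ} {p : Fin n → ℝ}

lemma initial_average_sq_le (hδ : 0 < δ) (X₀ : RowMat n d) :
    (‖rowMean X₀‖ + 2 / δ * (tau β γ 0 * ‖rowMean X₀‖)) ^ 2 ≤ 2 * lyapOne β γ δ X₀ := by
  have h1 : (2 / δ * (tau β γ 0 * ‖rowMean X₀‖)) ^ 2
      = 4 / δ ^ 2 * tau β γ 0 ^ 2 * ‖rowMean X₀‖ ^ 2 := by ring
  have h2 : 4 / δ ^ 2 * tau β γ 0 ^ 2 * ‖rowMean X₀‖ ^ 2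
      ≤ 8 / δ ^ 2 * tau β γ 0 ^ 2 * ‖rowMean X₀‖ ^ 2 := by gcongr; norm_num
  refine add_sq_le.trans ?_
  rw [h1, lyapOne]
  linarith

/-- The square of a sum of three terms is at most three times the sum of their squares. The factor
25/4 is dictated by the gradient term: 3 · 25/16 = 25/4 · 3/4, with c₁ ≥ 3/4. -/
lemma initial_consensus_sq_le (hδ : 0 < δ) (hτ0 : 0 ≤ tau β γ 0) (hτ : tau β γ 0 ≤ 1)
    (f : Fin n → EuclideanSpace ℝ (Fin d) → ℝ) (X₀ : RowMat n d) (v₀ : Fin n → ℝ) :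
    (colNorm (vecNorm Ct) (mix (conMat p) X₀)
        + 2 / δ * (tau β γ 0 * colNorm (vecNorm Ct) (mix (conMat p) X₀))
        + 5 / 4 * η / δ ^ 2
          * colNorm (vecNorm Ct) (mix (conMat p) (gradF f (invScale v₀ X₀)))) ^ 2
      ≤ 25 / 4 * lyapTwo f p Ct (1 / 4) δ η X₀ v₀ := by
  set x := colNorm (vecNorm Ct) (mix (conMat p) X₀) with hx
  set g := colNorm (vecNorm Ct) (mix (conMat p) (gradF f (invScale v₀ X₀))) with hg
  have h5 : lyapTwo f p Ct (1 / 4) δ η X₀ v₀ = x ^ 2 + 6 * (x ^ 2 / δ ^ 2)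
      + cOne (1 / 4) δ * (η ^ 2 / δ ^ 4 * g ^ 2) := by
    rw [lyapTwo, ← hx, ← hg]; ring
  have hc1 := cOne_ge hδ
  clear_value x g
  generalize tau β γ 0 = t at *
  generalize cOne (1 / 4) δ = c at *
  have h1 : (x + 2 / δ * (t * x) + 5 / 4 * η / δ ^ 2 * g) ^ 2
      ≤ 3 * (x ^ 2 + (2 / δ * (t * x)) ^ 2 + (5 / 4 * η / δ ^ 2 * g) ^ 2) := by
    nlinarith [sq_nonneg (x - 2 / δ * (t * x)), sq_nonneg (x - 5 / 4 * η / δ ^ 2 * g),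
      sq_nonneg (2 / δ * (t * x) - 5 / 4 * η / δ ^ 2 * g)]
  have h2 : (2 / δ * (t * x)) ^ 2 ≤ 4 * (x ^ 2 / δ ^ 2) := by
    have e : (2 / δ * (t * x)) ^ 2 = t ^ 2 * (4 * (x ^ 2 / δ ^ 2)) := by ring
    rw [e]
    exact mul_le_of_le_one_left (by positivity) (pow_le_one₀ hτ0 hτ)
  have h3 : (5 / 4 * η / δ ^ 2 * g) ^ 2 = 25 / 16 * (η ^ 2 / δ ^ 4 * g ^ 2) := by
    field_simp; ring
  have h4 : 3 / 4 * (η ^ 2 / δ ^ 4 * g ^ 2) ≤ c * (η ^ 2 / δ ^ 4 * g ^ 2) :=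
    mul_le_mul_of_nonneg_right hc1 (by positivity)
  have h6 : 0 ≤ x ^ 2 / δ ^ 2 := by positivity
  rw [h5]
  nlinarith [sq_nonneg x]

end Constants


/-! ### The main theorem -/

section Final

variable {n d : ℕ} {f : Fin n → EuclideanSpace ℝ (Fin d) → ℝ}
  {C Ct : Matrix (Fin n) (Fin n) ℝ} {p : Fin n → ℝ} {β γ δ κ η L : ℝ} {X₀ : RowMat n d}
  {v₀ : Fin n → ℝ} {xs : EuclideanSpace ℝ (Fin d)}

lemma lyapOne_nonneg (X₀ : RowMat n d) : 0 ≤ lyapOne β γ δ X₀ := by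
  unfold lyapOne; positivity

lemma lyapTwo_nonneg (hδ : 0 < δ) : 0 ≤ lyapTwo f p Ct (1 / 4) δ η X₀ v₀ := by
  have := cOne_ge hδ
  unfold lyapTwo; positivity

lemma lyapOne_le (hn : 0 < n) (hτ0 : 0 ≤ tau β γ 0) (hτ : tau β γ 0 ≤ 1) :
    lyapOne β γ δ X₀ ≤ (1 + 8 / δ ^ 2) * colNorm euclNorm X₀ ^ 2 := by
  have h1 := norm_rowMean_sq_le hn X₀
  rw [← colNorm_euclNorm_sq] at h1
  have h2 : tau β γ 0 ^ 2 ≤ 1 := pow_le_one₀ hτ0 hτ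
  calc lyapOne β γ δ X₀ = (1 + 8 / δ ^ 2 * tau β γ 0 ^ 2) * ‖rowMean X₀‖ ^ 2 := by
        rw [lyapOne]; ring
    _ ≤ (1 + 8 / δ ^ 2 * 1) * colNorm euclNorm X₀ ^ 2 := by gcongr
    _ = _ := by ring

lemma lyapTwo_le (hδ : 0 < δ) (h : IsAdaptedNorm C p δ Ct κ) :
    lyapTwo f p Ct (1 / 4) δ η X₀ v₀ ≤
      (1 + 6 / δ ^ 2) * colNorm euclNorm (mix (conMat p) X₀) ^ 2
        + cOne (1 / 4) δ * η ^ 2 / δ ^ 4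
          * colNorm euclNorm (mix (conMat p) (gradF f (invScale v₀ X₀))) ^ 2 := by
  have h0 := cOne_ge hδ
  have h1 := h.colNorm_le_eucl (mix (conMat p) X₀)
  have h2 := h.colNorm_le_eucl (mix (conMat p) (gradF f (invScale v₀ X₀)))
  exact add_le_add
    (mul_le_mul_of_nonneg_left (pow_le_pow_left₀ (colNorm_nonneg _ _) h1 2) (by positivity))
    (mul_le_mul_of_nonneg_left (pow_le_pow_left₀ (colNorm_nonneg _ _) h2 2) (by positivity))

/-- The second factor of the convergence bound. -/
noncomputable def rateConst (f : Fin n → EuclideanSpace ℝ (Fin d) → ℝ) (p : Fin n → ℝ)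
    (Ct : Matrix (Fin n) (Fin n) ℝ) (β γ δ κ ν η L : ℝ) (X₀ : RowMat n d) (v₀ : Fin n → ℝ)
    (xs : EuclideanSpace ℝ (Fin d)) : ℝ :=
  2 * (1 - tau β γ 0) * alpha (1 / 4) β γ 0 / tau β γ 0
      * (avgObj f (rowMean X₀) - avgObj f xs)
    + 3 * κ ^ 2 * ν ^ 2 * L / n * (cTwo * alpha (1 / 4) β γ 0 / (δ ^ 3 * tau β γ 0))
      * lyapTwo f p Ct (1 / 4) δ η X₀ v₀
    + 3 * κ ^ 2 * ν ^ 2 * L * vecNorm Ct (v₀ - p) ^ 2 / n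
      * (cTwo * alpha (1 / 4) β γ 0 / (δ ^ 3 * tau β γ 0)) * lyapOne β γ δ X₀
    + ‖rowMean X₀ - xs‖ ^ 2 / (2 * η)

lemma vInvBound_pos (hn : 0 < n) (hC : IsRegularColStochastic C) (hp : IsPerronVector C p)
    (hv : ∀ i, 0 < v₀ i) : 0 < vInvBound C v₀ := by
  obtain ⟨h1, h2⟩ := iterate_pos_and_inv_le hC hp hv 0 ⟨0, hn⟩
  exact (inv_pos.2 h1).trans_le h2

/-- A comparison of constants: α₀² = (1/4) α₀/τ₀, and the coefficients 375/8 and 15 of the two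
Lyapunov values are below 3 · 26 ≤ 3c₂. -/
lemma weighted_outputGap_le_rateConst (hn : 0 < n) (hL : 0 < L)
    (hf : ∀ i, IsConvexSmooth L (f i)) (hxs : ∀ x, avgObj f xs ≤ avgObj f x)
    (hC : IsRegularColStochastic C) (hv : ∀ i, 0 < v₀ i) (hvs : ∑ i, v₀ i = n) (hγ : 0 < γ)
    (hγ1 : γ ≤ 1) (hβ : 0 < β) (hβγ : β ≤ γ / 4) (hp : IsPerronVector C p) (hδ : 0 < δ)
    (h : IsAdaptedNorm C p δ Ct κ)
    (hη : StepCond₁ n L (1 / 4) δ κ (vInvBound C v₀) (vecNorm Ct (v₀ - p)) η) (m : ℕ) :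
    alpha (1 / 4) β γ m ^ 2 * outputGap f C (1 / 4) β γ η X₀ v₀ xs (m + 1)
      ≤ rateConst f p Ct β γ δ κ (vInvBound C v₀) η L X₀ v₀ xs := by
  have hκ : 0 < κ := one_pos.trans_le h.one_le
  have hν := vInvBound_pos hn hC hp hv
  have hη0 := hη.pos
  have hτ0 := tau_pos hγ hβ 0
  have hτ1 := tau_le_one hγ1 hβ 0
  have hα0 : 0 < alpha (1 / 4) β γ 0 := alpha_pos (by norm_num) hγ hβ 0
  have hατ : alpha (1 / 4) β γ 0 * tau β γ 0 = 1 / 4 := alpha_mul_tau _ hγ hβ 0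
  have hn' : (0 : ℝ) < n := by exact_mod_cast hn
  refine (weighted_outputGap_le hn hL hf hxs hC hv hvs hγ hγ1 hβ hβγ hp hδ h hη0
    (hη.sq_le hL hδ hκ hν) (hη.sq_dist_le hL) (hη.mul_le hL) m).trans ?_
  have h1 := initial_consensus_sq_le (η := η) (Ct := Ct) (p := p) hδ hτ0.le hτ1 f X₀ v₀
  have h2 := initial_average_sq_le (β := β) (γ := γ) hδ X₀
  have h3 := lyapOne_nonneg (β := β) (γ := γ) (δ := δ) X₀
  have h4 := lyapTwo_nonneg (f := f) (p := p) (Ct := Ct) (η := η) (X₀ := X₀) (v₀ := v₀) hδ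
  have h5 : 0 ≤ avgObj f (rowMean X₀) - avgObj f xs := sub_nonneg.2 (hxs _)
  have hc := cTwo_ge
  rw [rateConst]
  set Φ₁ := lyapOne β γ δ X₀
  set Φ₂ := lyapTwo f p Ct (1 / 4) δ η X₀ v₀
  set S := (colNorm (vecNorm Ct) (mix (conMat p) X₀)
              + 2 / δ * (tau β γ 0 * colNorm (vecNorm Ct) (mix (conMat p) X₀))
              + 5 / 4 * η / δ ^ 2
                * colNorm (vecNorm Ct) (mix (conMat p) (gradF f (invScale v₀ X₀)))) ^ 2
  set T := (‖rowMean X₀‖ + 2 / δ * (tau β γ 0 * ‖rowMean X₀‖)) ^ 2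
  set F := avgObj f (rowMean X₀) - avgObj f xs
  set D := ‖rowMean X₀ - xs‖ ^ 2 with hD
  have hD0 : 0 ≤ D := sq_nonneg _
  set a := vecNorm Ct (v₀ - p)
  set ν := vInvBound C v₀
  set α := alpha (1 / 4) β γ 0
  set τ := tau β γ 0
  clear_value Φ₁ Φ₂ S T F D a ν α τ
  have hα2 : α ^ 2 = 1 / 4 * (α / τ) := by
    rw [← hατ]; field_simp
  have hατ0 : 0 < α / τ := by positivity
  have e1 : 2 * (1 - τ) * α / τ * F = 2 * ((1 - τ) * (α / τ) * F) := by ring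
  have e2 : 3 * κ ^ 2 * ν ^ 2 * L / n * (cTwo * α / (δ ^ 3 * τ)) * Φ₂
      = 3 * cTwo * (L / n * ν ^ 2 * κ ^ 2 / δ ^ 3 * (α / τ) * Φ₂) := by field_simp
  have e3 : 3 * κ ^ 2 * ν ^ 2 * L * a ^ 2 / n * (cTwo * α / (δ ^ 3 * τ)) * Φ₁
      = 3 * cTwo * (L / n * ν ^ 2 * κ ^ 2 / δ ^ 3 * (α / τ) * (a ^ 2 * Φ₁)) := by field_simp
  rw [e1, e2, e3, hα2]
  have hF : 0 ≤ (1 - τ) * (α / τ) * F := mul_nonneg (mul_nonneg (sub_nonneg.2 hτ1) hατ0.le) h5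
  have hDη : 1 / 4 / (2 * η) * D = 1 / 4 * (D / (2 * η)) := by ring
  have hDη0 : 0 ≤ D / (2 * η) := by positivity
  have hS : 30 * (L / n) * ν ^ 2 * κ ^ 2 / δ ^ 3 * (1 / 4 * (α / τ) * S
        + a ^ 2 * (1 / 4 * (α / τ) * T))
      ≤ 30 * (L / n) * ν ^ 2 * κ ^ 2 / δ ^ 3 * (1 / 4 * (α / τ) * (25 / 4 * Φ₂)
        + a ^ 2 * (1 / 4 * (α / τ) * (2 * Φ₁))) := by gcongr
  have e4 : 30 * (L / n) * ν ^ 2 * κ ^ 2 / δ ^ 3 * (1 / 4 * (α / τ) * (25 / 4 * Φ₂)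
        + a ^ 2 * (1 / 4 * (α / τ) * (2 * Φ₁)))
      = 375 / 8 * (L / n * ν ^ 2 * κ ^ 2 / δ ^ 3 * (α / τ) * Φ₂)
        + 15 * (L / n * ν ^ 2 * κ ^ 2 / δ ^ 3 * (α / τ) * (a ^ 2 * Φ₁)) := by ring
  have h6 : 375 / 8 * (L / n * ν ^ 2 * κ ^ 2 / δ ^ 3 * (α / τ) * Φ₂)
      ≤ 3 * cTwo * (L / n * ν ^ 2 * κ ^ 2 / δ ^ 3 * (α / τ) * Φ₂) := by
    gcongr; linarith
  have h7 : 15 * (L / n * ν ^ 2 * κ ^ 2 / δ ^ 3 * (α / τ) * (a ^ 2 * Φ₁))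
      ≤ 3 * cTwo * (L / n * ν ^ 2 * κ ^ 2 / δ ^ 3 * (α / τ) * (a ^ 2 * Φ₁)) := by
    gcongr; linarith
  rw [e4] at hS
  rw [hDη]
  linarith

lemma rateConst_nonneg {ν : ℝ} (hL : 0 < L) (hxs : ∀ x, avgObj f xs ≤ avgObj f x)
    (hγ : 0 < γ) (hγ1 : γ ≤ 1) (hβ : 0 < β) (hδ : 0 < δ) (hη : 0 < η) :
    0 ≤ rateConst f p Ct β γ δ κ ν η L X₀ v₀ xs := by
  have hτ0 := tau_pos hγ hβ 0
  have hτ1 := sub_nonneg.2 (tau_le_one hγ1 hβ 0)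
  have hα0 : 0 < alpha (1 / 4) β γ 0 := alpha_pos (by norm_num) hγ hβ 0
  have h3 := lyapOne_nonneg (β := β) (γ := γ) (δ := δ) X₀
  have h4 := lyapTwo_nonneg (f := f) (p := p) (Ct := Ct) (η := η) (X₀ := X₀) (v₀ := v₀) hδ
  have h5 : 0 ≤ avgObj f (rowMean X₀) - avgObj f xs := sub_nonneg.2 (hxs _)
  have hc : 0 ≤ cTwo := (by norm_num : (0 : ℝ) ≤ 26).trans cTwo_ge
  unfold rateConst
  positivity

lemma outputGap_nonneg (hn : 0 < n) (hxs : ∀ x, avgObj f xs ≤ avgObj f x) (θ : ℝ) (K : ℕ) :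
    0 ≤ outputGap f C θ β γ η X₀ v₀ xs K := by
  have hn' : (0 : ℝ) < n := by exact_mod_cast hn
  have h := Finset.sum_le_sum fun i (_ : i ∈ Finset.univ) =>
    hxs (output f C θ β γ η X₀ v₀ K i)
  rw [Finset.sum_const, Finset.card_univ, Fintype.card_fin, nsmul_eq_mul] at h
  rw [outputGap, sub_nonneg, one_div, le_inv_mul_iff₀ hn']
  exact h

/-- A nonnegative sequence bounded by `M / α_{K-1}²` is `O(1 / K²)`. -/
lemma isBigO_of_weighted_le {G : ℕ → ℝ} {M : ℝ} (hγ : 0 < γ) (hβ : 0 < β) (hβ1 : β ≤ 1)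
    (hG : ∀ K, 0 ≤ G K) (h : ∀ m, alpha (1 / 4) β γ m ^ 2 * G (m + 1) ≤ M) :
    G =O[Filter.atTop] (fun K : ℕ => 1 / (K : ℝ) ^ 2) := by
  have hα0 : 0 < alpha (1 / 4) β γ 0 := alpha_pos (by norm_num) hγ hβ 0
  refine Asymptotics.IsBigO.of_bound (M / (alpha (1 / 4) β γ 0 * β) ^ 2) ?_
  filter_upwards [Filter.eventually_ge_atTop 1] with K hK
  obtain ⟨m, rfl⟩ := Nat.exists_eq_add_of_le' hK
  have hK0 : (0 : ℝ) < ((m + 1 : ℕ) : ℝ) := by positivity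
  rw [Real.norm_of_nonneg (hG _), Real.norm_of_nonneg (by positivity), mul_one_div, div_div,
    le_div_iff₀ (by positivity), ← mul_pow, mul_comm]
  refine le_trans ?_ (h m)
  -- β ≤ 1 gives β (m + 1) ≤ 1 + β m.
  have hle : alpha (1 / 4) β γ 0 * β * ((m + 1 : ℕ) : ℝ) ≤ alpha (1 / 4) β γ m := by
    rw [alpha_eq (1 / 4) β γ m, mul_assoc]
    gcongr
    push_cast
    linarith
  have := hG (m + 1)
  gcongr

end Final

end PushDIGing

open PushDIGing in
theorem mainTheorem1 (n d : ℕ) (hn : 0 < n)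
    (f : Fin n → EuclideanSpace ℝ (Fin d) → ℝ) (L : ℝ) (hL : 0 < L)
    (hf : ∀ i, IsConvexSmooth L (f i))
    (xstar : EuclideanSpace ℝ (Fin d)) (hxstar : ∀ x, avgObj f xstar ≤ avgObj f x)
    (C : Matrix (Fin n) (Fin n) ℝ) (hC : IsRegularColStochastic C)
    (X₀ : RowMat n d) (v₀ : Fin n → ℝ) (hv₀ : ∀ i, 0 < v₀ i) (hv₀_sum : ∑ i, v₀ i = n)
    (θ β γ : ℝ) (hθ : θ = 1 / 4) (hγ_pos : 0 < γ) (hγ_le : γ ≤ 1)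
    (hβ_pos : 0 < β) (hβ_le : β ≤ γ / 4) :
    -- the Perron vector, the spectral gap and the adapted norms exist
    (∃! p : Fin n → ℝ, IsPerronVector C p) ∧
    ∀ p : Fin n → ℝ, IsPerronVector C p →
      mixRadius C p < 1 ∧
      ∀ δ : ℝ, 0 < δ → ENNReal.ofReal δ < 1 - mixRadius C p →
        (∃ (Ct : Matrix (Fin n) (Fin n) ℝ) (κ : ℝ), IsAdaptedNorm C p δ Ct κ) ∧
        -- the convergence guarantee, for every adapted norm and every admissible step size
        ∀ (Ct : Matrix (Fin n) (Fin n) ℝ) (κ : ℝ), IsAdaptedNorm C p δ Ct κ →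
          ∀ η : ℝ,
            StepCond₁ n L θ δ κ (vInvBound C v₀) (vecNorm Ct (v₀ - p)) η →
            StepCond₂ L θ β γ δ κ (vInvBound C v₀) η →
            (∀ K : ℕ, 1 ≤ K →
              outputGap f C θ β γ η X₀ v₀ xstar K ≤
                1 / alpha θ β γ (K - 1) ^ 2
                * (1 + 3 * θ + 12 * vInvBound C v₀ ^ 2 * κ ^ 2 * (1 - δ) ^ (2 * K)
                    * vecNorm Ct (v₀ - p) ^ 2 * η * L / n)
                * (2 * (1 - tau β γ 0) * alpha θ β γ 0 / tau β γ 0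
                      * (avgObj f (rowMean X₀) - avgObj f xstar)
                    + 3 * κ ^ 2 * vInvBound C v₀ ^ 2 * L / n
                      * (cTwo * alpha θ β γ 0 / (δ ^ 3 * tau β γ 0))
                      * lyapTwo f p Ct θ δ η X₀ v₀
                    + 3 * κ ^ 2 * vInvBound C v₀ ^ 2 * L * vecNorm Ct (v₀ - p) ^ 2 / n
                      * (cTwo * alpha θ β γ 0 / (δ ^ 3 * tau β γ 0))
                      * lyapOne β γ δ X₀
                    + ‖rowMean X₀ - xstar‖ ^ 2 / (2 * η))) ∧
            -- bounds on the two initial Lyapunov values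
            lyapOne β γ δ X₀ ≤ (1 + 8 / δ ^ 2) * colNorm euclNorm X₀ ^ 2 ∧
            lyapTwo f p Ct θ δ η X₀ v₀ ≤
              (1 + 6 / δ ^ 2) * colNorm euclNorm (mix (conMat p) X₀) ^ 2
                + cOne θ δ * η ^ 2 / δ ^ 4
                  * colNorm euclNorm (mix (conMat p) (gradF f (invScale v₀ X₀))) ^ 2 ∧
            -- the resulting rate
            (fun K : ℕ => outputGap f C θ β γ η X₀ v₀ xstar K)
              =O[Filter.atTop] (fun K : ℕ => 1 / (K : ℝ) ^ 2) := by
  subst hθ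
  refine ⟨existsUnique_perron hn hC, fun p hp => ⟨mixRadius_lt_one hn hC hp, fun δ hδ hδr =>
    ⟨exists_isAdaptedNorm hn hC.colStochastic hp hδ hδr, fun Ct κ h η hη₁ _ => ?_⟩⟩⟩
  have hτ0 := tau_pos hγ_pos hβ_pos 0
  have hτ1 := tau_le_one hγ_le hβ_pos 0
  have hmain := weighted_outputGap_le_rateConst (X₀ := X₀) hn hL hf hxstar hC hv₀ hv₀_sum hγ_pos
    hγ_le hβ_pos hβ_le hp hδ h hη₁
  refine ⟨fun K hK => ?_, lyapOne_le hn hτ0.le hτ1, lyapTwo_le hδ h,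
    isBigO_of_weighted_le hγ_pos hβ_pos (by linarith) (outputGap_nonneg hn hxstar _) hmain⟩
  obtain ⟨m, rfl⟩ := Nat.exists_eq_add_of_le' hK
  have hα : 0 < alpha (1 / 4) β γ m := alpha_pos (by norm_num) hγ_pos hβ_pos m
  have hR := rateConst_nonneg (f := f) (p := p) (Ct := Ct) (κ := κ) (X₀ := X₀) (v₀ := v₀)
    (ν := vInvBound C v₀) hL hxstar hγ_pos hγ_le hβ_pos hδ hη₁.pos
  have hδ1 : 0 ≤ 1 - δ := sub_nonneg.2 h.gap_le_one
  have hη0 := hη₁.pos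
  change _ ≤ _ * rateConst f p Ct β γ δ κ (vInvBound C v₀) η L X₀ v₀ xstar
  rw [Nat.add_sub_cancel]
  -- The estimate already holds without the middle factor; that factor is at least 1 and `rateConst`
  -- is nonnegative, so inserting it only weakens the bound.
  refine le_trans ?_ (mul_le_mul_of_nonneg_right (b := 1 / alpha (1 / 4) β γ m ^ 2) ?_ hR)
  · rw [one_div_mul_eq_div, le_div_iff₀' (pow_pos hα 2)]
    exact hmain m
  · refine le_mul_of_one_le_right (by positivity) ?_
    have : 0 ≤ 12 * vInvBound C v₀ ^ 2 * κ ^ 2 * (1 - δ) ^ (2 * (m + 1))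
        * vecNorm Ct (v₀ - p) ^ 2 * η * L / n := by positivity
    linarith
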